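/- **Setting.** Let $V$ be a two-dimensional complex vector space (the spin space at a point of space-time) with a spin metric $\epsilon$, i.e. a non-degenerate alternating bilinear form, and let $W$ be the primed spin space, i.e. the complex conjugate of $V$: there is a conjugate-linear isomorphism $V\to W$, $x\mapsto\bar x$, and $W$ carries $\bar\epsilon(\bar x,\bar y)=\overline{\epsilon(x,y)}$. All integers below are $\ge 0$. $\mathcal S_{k,l}$ is the space of symmetric spinors of valence $(k,l)$: multilinear forms $\phi_{A_1\dots A_kA'_1\dots A'_l}$ in $k$ vectors of $V$ and $l$ vectors of $W$ that are symmetric in the unprimed and symmetric in the primed indices. The conjugate $\bar\phi\in\mathcal S_{l,k}$ of $\phi\in\mathcal S_{k,l}$ is $\bar\phi(v;w)=\overline{\phi(\bar w;\bar v)}$, where $\bar w$, $\bar v$ are the lists of conjugate vectors. Indices are raised and lowered with $\epsilon$ and $\bar\epsilon$, with the convention $\alpha_A=\alpha^B\epsilon_{BA}$. For $\phi\in\mathcal S_{k,l}$, $\psi\in\mathcal S_{n,m}$, $i\le\min(k,n)$, $j\le\min(l,m)$, the symmetric product $\phi\overset{i,j}{\odot}\psi\in\mathcal S_{k+n-2i,\,l+m-2j}$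 is obtained by contracting the last $i$ unprimed and last $j$ primed indices of $\phi$ (in raised position) with those of $\psi$ (in lowered position), $$\phi_{A_1\dots A_{k-i}A'_1\dots A'_{l-j}}{}^{B_1\dots B_iB'_1\dots B'_j}\,\psi_{A_{k-i+1}\dots A_{k+n-2i}A'_{l-j+1}\dots A'_{l+m-2j}B_1\dots B_iB'_1\dots B'_j},$$ and then symmetrizing (averaging over permutations) over all free unprimed indices and over all free primed indices. The associativity coefficients are $$F_{i,r,k}^{t,m,M}=\sum_{p=0}^M\sum_{q=0}^{M-p}\frac{(-1)^{t-p+q}\binom{k-m}{p}\binom{m}{M-p-q}\binom{k-m-p}{q}\binom{r-m}{t-p}\binom{i-t}{M-p-q}\binom{t-p}{q}}{\binom{i+k-M-p+1}{M-p}\binom{M-p}{q}\binom{k-2m+r}{t}},$$ where $\binom{a}{b}=a(a-1)\cdots(a-b+1)/b!$ for integers $a$ and $b\ge0$, and $\binom ab=0$ for $b<0$. **Theorem.** The symmetric product has the following properties. 1. It is graded anti-commutative: for $\phi\in\mathcal S_{i,j}$, $\omega\in\mathcal S_{r,s}$, $m\le\min(i,r)$, $n\le\min(j,s)$, $$\phi\overset{m,n}{\odot}\omega=(-1)^{m+n}\,\omega\overset{m,n}{\odot}\phi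 .$$ 2. It is non-associative: for $\omega\in\mathcal S_{r,s}$, $\varphi\in\mathcal S_{k,l}$, $\phi\in\mathcal S_{i,j}$ and all $m\le\min(r,k)$, $n\le\min(s,l)$, $t\le\min(r+k-2m,i)$, $u\le\min(s+l-2n,j)$, $$(\omega\overset{m,n}{\odot}\varphi)\overset{t,u}{\odot}\phi=\sum_{M=0}^{\min(i,k)}\sum_{N=0}^{\min(j,l)}(-1)^{t+u+M+N}F_{i,r,k}^{t,m,M}F_{j,s,l}^{u,n,N}\;\omega\overset{t+m-M,\,u+n-N}{\odot}\bigl(\varphi\overset{M,N}{\odot}\phi\bigr).$$ Terms in which the outer product on the right is not defined are read as zero; this is harmless, since for $m\le\min(r,k)$, $t\le\min(r+k-2m,i)$, $M\le\min(i,k)$ one has $F_{i,r,k}^{t,m,M}=0$ unless $0\le t+m-M\le\min(r,k+i-2M)$. Moreover, the two bracketings do differ in general: there are valences, contraction numbers for which both sides are defined, and spinors $\omega,\varphi,\phi$ with $(\omega\overset{m,n}{\odot}\varphi)\overset{t,u}{\odot}\phi\ne\omega\overset{m,n}{\odot}(\varphi\overset{t,u}{\odot}\phi)$. 3. It is Hermitian: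 for $\phi\in\mathcal S_{i,j}$, $\omega\in\mathcal S_{r,s}$, $m\le\min(i,r)$, $n\le\min(j,s)$, $$\overline{\phi\overset{m,n}{\odot}\omega}=\bar\phi\overset{n,m}{\odot}\bar\omega .$$ -/

import Mathlib

noncomputable section

/-- A spin metric on `U`: a non-degenerate alternating form on a two-dimensional complex vector
space, `form x y = ε_{AB} x^A y^B`. -/
structure SpinMetric (U : Type*) [AddCommGroup U] [Module ℂ U] where
  finrank_eq_two : Module.finrank ℂ U = 2
  form : LinearMap.BilinForm ℂ U
  isAlt : form.IsAlt
  nondegenerate : form.Nondegenerate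

namespace SpinMetric

variable {U : Type*} [AddCommGroup U] [Module ℂ U] (e : SpinMetric U)

theorem finiteDimensional (e : SpinMetric U) : FiniteDimensional ℂ U :=
  Module.finite_of_finrank_pos (by rw [e.finrank_eq_two]; norm_num)

/-- Some basis `b₀, b₁` of the spin space. -/
def basis : Module.Basis (Fin 2) ℂ U :=
  haveI := e.finiteDimensional
  Module.finBasisOfFinrankEq ℂ U e.finrank_eq_two

/-- The dual basis `b⁰, b¹` with respect to the spin metric: `ε(b^A, b_B) = δ^A_B`. With the
convention `α_A = α^B ε_{BA}` for lowering and raising indices, a covector `α` has the raised vector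
`∑ A, α(b_A) b^A`, hence `α^A β_A = ∑ A, α(b_A) β(b^A)`. -/
def dualBasis : Module.Basis (Fin 2) ℂ U :=
  haveI := e.finiteDimensional
  e.form.dualBasis e.nondegenerate e.basis

theorem form_dualBasis (A B : Fin 2) :
    e.form (e.dualBasis A) (e.basis B) = if B = A then 1 else 0 := by
  have := e.finiteDimensional
  exact LinearMap.BilinForm.apply_dualBasis_left _ _ _ _

theorem basis_spec (x : U) : ∑ A, e.form (e.dualBasis A) x • e.basis A = x := by
  have h := e.basis.sum_repr x
  have h2 : ∀ A, e.form (e.dualBasis A) x = e.basis.repr x A := by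
    intro A
    conv_lhs => rw [← h]
    simp only [map_sum, map_smul, form_dualBasis, smul_eq_mul]
    simp
  simp_rw [h2]
  exact h

/-- The contraction of one pair of indices does not depend on the basis: for every normalised dyad
`(o, ι)` it is `f^A{}_A = f_{10} - f_{01}`. -/
theorem sum_basis_dualBasis (f : LinearMap.BilinForm ℂ U) (o ι : U) (h : e.form o ι = 1) :
    ∑ A, f (e.basis A) (e.dualBasis A) = f ι o - f o ι := by
  have hneg : ∀ x y, e.form x y = - e.form y x := fun x y => (e.isAlt.neg_eq y x).symm
  have key : ∀ A, e.dualBasis A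
      = e.form (e.dualBasis A) ι • o - e.form (e.dualBasis A) o • ι := by
    intro A
    -- `o, ι` span the two-dimensional space
    have hli : LinearIndependent ℂ ![o, ι] := by
      rw [LinearIndependent.pair_iff]
      intro s t hst
      have h1 := congrArg (fun z => e.form z ι) hst
      have h2 := congrArg (fun z => e.form o z) hst
      simp [h, e.isAlt o, e.isAlt ι] at h1 h2
      exact ⟨h1, h2⟩
    have := e.finiteDimensional
    let c := basisOfLinearIndependentOfCardEqFinrank hli (by simp [e.finrank_eq_two])
    have hc : ∀ x, ∃ s t : ℂ, x = s • o + t • ι := by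
      intro x
      refine ⟨c.repr x 0, c.repr x 1, ?_⟩
      have := c.sum_repr x
      rw [Fin.sum_univ_two] at this
      simpa [c] using this.symm
    obtain ⟨s, t, hx⟩ := hc (e.dualBasis A)
    have hιo : e.form ι o = -1 := by rw [hneg, h]
    rw [hx]
    simp [h, hιo, e.isAlt o, e.isAlt ι]
  have h1 : ∀ A, f (e.basis A) (e.dualBasis A)
      = f (e.form (e.dualBasis A) ι • e.basis A) o
        - f (e.form (e.dualBasis A) o • e.basis A) ι := by
    intro A
    conv_lhs => rw [key A]
    simp
  simp_rw [h1]
  rw [Finset.sum_sub_distrib, ← LinearMap.sum_apply, ← LinearMap.sum_apply, ← map_sum, ← map_sum,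
    e.basis_spec, e.basis_spec]

end SpinMetric

/-- The algebraic data of the spinors at a point of space-time: the spin space `V` with its spin
metric `ε`, and the primed spin space `W`, identified with the complex conjugate of `V`. -/
structure SpinSpace (V W : Type*) [AddCommGroup V] [Module ℂ V] [AddCommGroup W] [Module ℂ W] where
  metric : SpinMetric V
  conjEquiv : V ≃ₛₗ[starRingEnd ℂ] W

/-- Symmetric spinors of valence `(k, l)`, i.e. `φ_{A₁…A_k A'₁…A'_l}` symmetric in the unprimed and
in the primed indices: multilinear forms `φ v w` in `k` vectors `v` of `V` and `l` vectors `w` of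
`W`. -/
def SymSpinor (V W : Type*) [AddCommGroup V] [Module ℂ V] [AddCommGroup W] [Module ℂ W]
    (k l : ℕ) :
    Submodule ℂ (MultilinearMap ℂ (fun _ : Fin k => V)
      (MultilinearMap ℂ (fun _ : Fin l => W) ℂ)) where
  carrier := {φ | (∀ (σ : Equiv.Perm (Fin k)) v w, φ (v ∘ σ) w = φ v w) ∧
    ∀ (τ : Equiv.Perm (Fin l)) v w, φ v (w ∘ τ) = φ v w}
  add_mem' := by
    rintro a b ⟨ha, ha'⟩ ⟨hb, hb'⟩
    exact ⟨fun σ v w => by simp [ha, hb], fun τ v w => by simp [ha', hb']⟩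
  zero_mem' := by simp
  smul_mem' := by
    rintro c a ⟨ha, ha'⟩
    exact ⟨fun σ v w => by simp [ha], fun τ v w => by simp [ha']⟩

/-- `i` indices of a `k`-index and an `n`-index object can be contracted, leaving `K` free ones. -/
def Contractible (k n i K : ℕ) : Prop := i ≤ k ∧ i ≤ n ∧ K + 2 * i = k + n

instance (k n i K : ℕ) : Decidable (Contractible k n i K) := by
  unfold Contractible; infer_instance

namespace Contractible

variable {U : Type*} {k n i K : ℕ}

/-- Arguments of the first factor: the first `k - i` free ones, then the contracted ones. -/
def fstArgs (h : Contractible k n i K) (v : Fin K → U) (x : Fin i → U) : Fin k → U := fun a =>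
  if ha : (a : ℕ) < k - i then v ⟨a, by obtain ⟨_, _, _⟩ := h; omega⟩
  else x ⟨a - (k - i), by obtain ⟨_, _, _⟩ := h; omega⟩

/-- Arguments of the second factor: the last `n - i` free ones, then the contracted ones. -/
def sndArgs (h : Contractible k n i K) (v : Fin K → U) (x : Fin i → U) : Fin n → U := fun a =>
  if ha : (a : ℕ) < n - i then v ⟨k - i + a, by obtain ⟨_, _, _⟩ := h; omega⟩
  else x ⟨a - (n - i), by obtain ⟨_, _, _⟩ := h; omega⟩

theorem args_update_lt (h : Contractible k n i K) (c : Fin K) (hc : (c : ℕ) < k - i) :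
    (∀ [DecidableEq (Fin K)] (v : Fin K → U) (x : Fin i → U) (z : U),
      h.fstArgs (Function.update v c z) x
        = Function.update (h.fstArgs v x) ⟨c, by omega⟩ z) ∧
    (∀ [DecidableEq (Fin K)] (v : Fin K → U) (x : Fin i → U) (z : U),
      h.sndArgs (Function.update v c z) x = h.sndArgs v x) := by
  constructor
  · intro _ v x z
    funext a
    simp only [fstArgs, Function.update_apply, Fin.ext_iff]
    split_ifs <;> first | rfl | omega
  · intro _ v x z
    funext a
    simp only [sndArgs, Function.update_apply, Fin.ext_iff]
    split_ifs <;> first | rfl | omega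

theorem args_update_ge (h : Contractible k n i K) (c : Fin K) (hc : ¬ (c : ℕ) < k - i) :
    (∀ [DecidableEq (Fin K)] (v : Fin K → U) (x : Fin i → U) (z : U),
      h.sndArgs (Function.update v c z) x
        = Function.update (h.sndArgs v x)
            ⟨c - (k - i), by obtain ⟨_, _, _⟩ := h; omega⟩ z) ∧
    (∀ [DecidableEq (Fin K)] (v : Fin K → U) (x : Fin i → U) (z : U),
      h.fstArgs (Function.update v c z) x = h.fstArgs v x) := by
  obtain ⟨h1, h2, h3⟩ := h
  constructor
  · intro _ v x z
    funext a
    simp only [sndArgs, Function.update_apply, Fin.ext_iff]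
    split_ifs <;> first | rfl | omega
  · intro _ v x z
    funext a
    simp only [fstArgs, Function.update_apply, Fin.ext_iff]
    split_ifs <;> first | rfl | omega

end Contractible

namespace SpinSpace

variable {V W : Type*} [AddCommGroup V] [Module ℂ V] [AddCommGroup W] [Module ℂ W]
  (S : SpinSpace V W)

/-- The complex conjugate spin metric on the primed spin space, `ε̄(x̄, ȳ) = conj (ε(x, y))`. -/
def metricBar : SpinMetric W where
  finrank_eq_two := by
    rw [← S.metric.finrank_eq_two]
    have h := lift_rank_eq_of_equiv_equiv (starRingEnd ℂ) S.conjEquiv.toAddEquiv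
      (starRingAut (R := ℂ)).bijective (fun r m => S.conjEquiv.map_smulₛₗ r m)
    have h2 := congrArg Cardinal.toNat h
    simpa [Module.finrank] using h2.symm
  form := LinearMap.mk₂ ℂ
    (fun x y => starRingEnd ℂ (S.metric.form (S.conjEquiv.symm x) (S.conjEquiv.symm y)))
    (by intros; simp) (by intros; simp [map_smulₛₗ])
    (by intros; simp) (by intros; simp [map_smulₛₗ])
  isAlt := by
    intro x
    simp [S.metric.isAlt (S.conjEquiv.symm x)]
  nondegenerate := by
    constructor
    · intro x hx
      have : S.conjEquiv.symm x = 0 := by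
        refine S.metric.nondegenerate.1 _ fun y => ?_
        simpa using hx (S.conjEquiv y)
      simpa using this
    · intro x hx
      have : S.conjEquiv.symm x = 0 := by
        refine S.metric.nondegenerate.2 _ fun y => ?_
        simpa using hx (S.conjEquiv y)
      simpa using this

/-- The contraction
`φ_{A₁…A_{k-i}}^{B₁…B_i} ψ_{A_{k-i+1}…A_{k+n-2i} B₁…B_i}`, with the analogous contraction of `j`
primed indices, before symmetrization; the free slots are filled with `v` and `w`. -/
def contract {k l n m i j K L : ℕ} (hK : Contractible k n i K) (hL : Contractible l m j L)
    (φ : SymSpinor V W k l) (ψ : SymSpinor V W n m) (v : Fin K → V) (w : Fin L → W) : ℂ :=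
  ∑ B : Fin i → Fin 2, ∑ B' : Fin j → Fin 2,
    φ.1 (hK.fstArgs v fun a => S.metric.basis (B a))
        (hL.fstArgs w fun a => S.metricBar.basis (B' a)) *
      ψ.1 (hK.sndArgs v fun a => S.metric.dualBasis (B a))
        (hL.sndArgs w fun a => S.metricBar.dualBasis (B' a))

/-- `contract` as a multilinear map. -/
def contractMap {k l n m i j K L : ℕ} (hK : Contractible k n i K) (hL : Contractible l m j L)
    (φ : SymSpinor V W k l) (ψ : SymSpinor V W n m) :
    MultilinearMap ℂ (fun _ : Fin K => V) (MultilinearMap ℂ (fun _ : Fin L => W) ℂ) where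
  toFun v :=
    { toFun := fun w => S.contract hK hL φ ψ v w
      map_update_add' := by
        intro _ w c x y
        simp only [contract, ← Finset.sum_add_distrib]
        refine Finset.sum_congr rfl fun B _ => Finset.sum_congr rfl fun B' _ => ?_
        by_cases hc : (c : ℕ) < l - j
        · obtain ⟨h1, h2⟩ := hL.args_update_lt (U := W) c hc
          rw [h1, h1, h1, h2, h2, h2, MultilinearMap.map_update_add, add_mul]
        · obtain ⟨h1, h2⟩ := hL.args_update_ge (U := W) c hc
          rw [h1, h1, h1, h2, h2, h2, MultilinearMap.map_update_add, mul_add]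
      map_update_smul' := by
        intro _ w c r x
        simp only [contract, smul_eq_mul, Finset.mul_sum]
        refine Finset.sum_congr rfl fun B _ => Finset.sum_congr rfl fun B' _ => ?_
        by_cases hc : (c : ℕ) < l - j
        · obtain ⟨h1, h2⟩ := hL.args_update_lt (U := W) c hc
          rw [h1, h1, h2, h2, MultilinearMap.map_update_smul, smul_eq_mul, mul_assoc]
        · obtain ⟨h1, h2⟩ := hL.args_update_ge (U := W) c hc
          rw [h1, h1, h2, h2, MultilinearMap.map_update_smul, smul_eq_mul, mul_left_comm] }
  map_update_add' := by
    intro _ v c x y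
    ext w
    simp only [contract, ← Finset.sum_add_distrib, MultilinearMap.coe_mk, add_apply]
    refine Finset.sum_congr rfl fun B _ => Finset.sum_congr rfl fun B' _ => ?_
    by_cases hc : (c : ℕ) < k - i
    · obtain ⟨h1, h2⟩ := hK.args_update_lt (U := V) c hc
      rw [h1, h1, h1, h2, h2, h2, MultilinearMap.map_update_add, add_apply, add_mul]
    · obtain ⟨h1, h2⟩ := hK.args_update_ge (U := V) c hc
      rw [h1, h1, h1, h2, h2, h2, MultilinearMap.map_update_add, add_apply, mul_add]
  map_update_smul' := by
    intro _ v c r x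
    ext w
    simp only [contract, smul_eq_mul, Finset.mul_sum, MultilinearMap.coe_mk,
      smul_apply]
    refine Finset.sum_congr rfl fun B _ => Finset.sum_congr rfl fun B' _ => ?_
    by_cases hc : (c : ℕ) < k - i
    · obtain ⟨h1, h2⟩ := hK.args_update_lt (U := V) c hc
      rw [h1, h1, h2, h2, MultilinearMap.map_update_smul, smul_apply, smul_eq_mul,
        mul_assoc]
    · obtain ⟨h1, h2⟩ := hK.args_update_ge (U := V) c hc
      rw [h1, h1, h2, h2, MultilinearMap.map_update_smul, smul_apply, smul_eq_mul,
        mul_left_comm]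

end SpinSpace

/-- Symmetrization over all unprimed and all primed indices (with weight one). -/
def symmetrize {V W : Type*} [AddCommGroup V] [Module ℂ V] [AddCommGroup W] [Module ℂ W] {K L : ℕ}
    (f : MultilinearMap ℂ (fun _ : Fin K => V) (MultilinearMap ℂ (fun _ : Fin L => W) ℂ)) :
    SymSpinor V W K L where
  val :=
    { toFun := fun v =>
        ((K.factorial : ℂ)⁻¹ * (L.factorial : ℂ)⁻¹) •
          ∑ σ : Equiv.Perm (Fin K), ∑ τ : Equiv.Perm (Fin L), (f (v ∘ σ)).domDomCongr τ
      map_update_add' := by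
        intro _ v c x y
        rw [← smul_add, ← Finset.sum_add_distrib]
        congr 1
        refine Finset.sum_congr rfl fun σ _ => ?_
        rw [← Finset.sum_add_distrib]
        refine Finset.sum_congr rfl fun τ _ => ?_
        have h : ∀ z, Function.update v c z ∘ σ = Function.update (v ∘ σ) (σ.symm c) z :=
          fun z => by
          funext a
          simp [Function.update_apply, Equiv.eq_symm_apply]
        rw [h, h, h, MultilinearMap.map_update_add]
        rfl
      map_update_smul' := by
        intro _ v c r x
        rw [smul_comm r]
        rw [Finset.smul_sum (r := r)]
        congr 1
        refine Finset.sum_congr rfl fun σ _ => ?_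
        rw [Finset.smul_sum]
        refine Finset.sum_congr rfl fun τ _ => ?_
        have h : ∀ z, Function.update v c z ∘ σ = Function.update (v ∘ σ) (σ.symm c) z :=
          fun z => by
          funext a
          simp [Function.update_apply, Equiv.eq_symm_apply]
        rw [h, h, MultilinearMap.map_update_smul]
        rfl }
  property := by
    constructor
    · intro ρ v w
      simp only [MultilinearMap.coe_mk, smul_apply, sum_apply,
        MultilinearMap.domDomCongr_apply]
      congr 1
      exact Fintype.sum_equiv (Equiv.mulLeft ρ) _ _ fun σ => rfl
    · intro ρ v w
      simp only [MultilinearMap.coe_mk, smul_apply, sum_apply,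
        MultilinearMap.domDomCongr_apply]
      congr 1
      refine Finset.sum_congr rfl fun σ _ => ?_
      exact Fintype.sum_equiv (Equiv.mulLeft ρ) _ _ fun τ => rfl

theorem symmetrize_apply {V W : Type*} [AddCommGroup V] [Module ℂ V] [AddCommGroup W] [Module ℂ W]
    {K L : ℕ}
    (f : MultilinearMap ℂ (fun _ : Fin K => V) (MultilinearMap ℂ (fun _ : Fin L => W) ℂ))
    (v : Fin K → V) (w : Fin L → W) :
    (symmetrize f).1 v w = ((K.factorial : ℂ)⁻¹ * (L.factorial : ℂ)⁻¹) *
      ∑ σ : Equiv.Perm (Fin K), ∑ τ : Equiv.Perm (Fin L), f (v ∘ σ) (w ∘ τ) := by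
  simp only [symmetrize, MultilinearMap.coe_mk, smul_apply,
    sum_apply, MultilinearMap.domDomCongr_apply, smul_eq_mul]
  rfl

namespace SpinSpace

variable {V W : Type*} [AddCommGroup V] [Module ℂ V] [AddCommGroup W] [Module ℂ W]
  (S : SpinSpace V W)

/-- The symmetric product `φ ⊙^{i,j} ψ` of `φ ∈ S_{k,l}` and `ψ ∈ S_{n,m}`. It is defined for
`i ≤ min k n`, `j ≤ min l m` and lies in `S_{k+n-2i, l+m-2j}`. To avoid transporting along equalities
of valences, the target valence `(K, L)` is a parameter; the value is `0` by convention if `(K, L)`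
is not `(k+n-2i, l+m-2j)` or if `i, j` are out of range. -/
def symProd {k l n m : ℕ} (i j : ℕ) {K L : ℕ} (φ : SymSpinor V W k l) (ψ : SymSpinor V W n m) :
    SymSpinor V W K L :=
  if h : Contractible k n i K ∧ Contractible l m j L then
    symmetrize (S.contractMap h.1 h.2 φ ψ)
  else 0

/-- The complex conjugate `φ̄ ∈ S_{l,k}` of `φ ∈ S_{k,l}`: the conjugate of `φ`, evaluated on the
conjugate arguments. -/
def bar {k l : ℕ} (φ : SymSpinor V W k l) : SymSpinor V W l k where
  val :=
    { toFun := fun v =>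
        { toFun := fun w => starRingEnd ℂ (φ.1 (S.conjEquiv.symm ∘ w) (S.conjEquiv ∘ v))
          map_update_add' := by
            intro _ w c x y
            simp only [Function.comp_update, map_add, MultilinearMap.map_update_add,
              add_apply]
          map_update_smul' := by
            intro _ w c r x
            simp [Function.comp_update, map_smulₛₗ] }
      map_update_add' := by
        intro _ v c x y
        ext w
        simp [Function.comp_update]
      map_update_smul' := by
        intro _ v c r x
        ext w
        simp [Function.comp_update, map_smulₛₗ] }
  property := by
    constructor
    · intro σ v w
      exact congrArg (starRingEnd ℂ) (φ.2.2 σ (S.conjEquiv.symm ∘ w) (S.conjEquiv ∘ v))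
    · intro τ v w
      exact congrArg (starRingEnd ℂ) (φ.2.1 τ (S.conjEquiv.symm ∘ w) (S.conjEquiv ∘ v))

end SpinSpace

/-- Binomial coefficients with integer entries: `n(n-1)⋯(n-k+1)/k!`, and `0` for `k < 0`. -/
def binom (n k : ℤ) : ℚ := if 0 ≤ k then (Ring.choose n k.toNat : ℚ) else 0

/-- The associativity coefficients `F_{i,r,k}^{t,m,M}`. -/
def assocCoeff (i r k t m M : ℕ) : ℚ :=
  ∑ p ∈ Finset.range (M + 1), ∑ q ∈ Finset.range (M - p + 1),
    (-1 : ℚ) ^ ((t : ℤ) - p + q) *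
      binom (k - m) p * binom m (M - p - q) * binom (k - m - p) q *
      binom (r - m) (t - p) * binom (i - t) (M - p - q) * binom (t - p) q /
    (binom (i + k - M - p + 1) (M - p) * binom (M - p) q * binom (k - 2 * m + r) t)

end

/-! Every assertion is linear in each spinor (conjugate-linear for the conjugate), and the powers
`powSpinor k l a b` span the symmetric spinors: contracting a spinor fully with a power gives, up to
sign, its value on constant arguments, and by polarization these values determine the spinor. It is
therefore enough to treat powers, evaluated on constant arguments `x` and `y`, where symmetrization
has no effect and contraction with a power inserts its vector into the contracted slots. A product
of two powers becomes a product of powers of brackets `e.form a x`. Anti-commutativity is then the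
skewness of the bracket, and Hermiticity is its compatibility with conjugation.

For the re-bracketing formula the unprimed and primed brackets separate, and one scalar identity
remains, `sum_assocCoeff_mul_polar`. Expanding the polarized product of the powers of `a` and `b` on
its left side gives monomials in the four brackets (ba), (bx), (ca), (cx). Each monomial is
developed in its Gordan series (the Clebsch-Gordan decomposition), a sum of powers of the
determinant (ba)(cx) - (bx)(ca) times polarizations of powers of `b` and `c`. By the Plücker
relation this determinant is (bc)(ax), so the terms of the series are exactly those of the opposite
bracketing. The coefficients F are the expansion coefficients times the Gordan coefficients.

The Gordan series (`gordanError_eq_zero`) rests on two properties of Cayley's operator Ω = ∂₁∂₄ -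
∂₂∂₃: its commutator with multiplication by the determinant (`omegaCoeff_recurrence`), and the fact
that it annihilates polarizations (`sum_choose_mul_omegaCoeff`). -/

open Finset

/-! ### Cayley's Ω-process on monomials -/

/-- The value at `(1, 1, 1, 1)` of `(∂₁∂₄ - ∂₂∂₃)^j` applied to the monomial
`X₁^m X₂^α X₃^γ X₄^β`. -/
def omegaCoeff (m α γ β j : ℕ) : ℚ :=
  ∑ q ∈ range (j + 1), (-1) ^ q * (j.choose q : ℚ) *
    ((m.descFactorial (j - q) : ℚ) * β.descFactorial (j - q)) *
    ((α.descFactorial q : ℚ) * γ.descFactorial q)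

theorem omegaCoeff_zero (m α γ β : ℕ) : omegaCoeff m α γ β 0 = 1 := by
  simp [omegaCoeff]

/-- The commutator of (∂₁∂₄)^(a+1) with multiplication by X₁X₄, read off on monomials. -/
theorem descFactorial_mul_descFactorial_succ (m β a : ℕ) :
    (((m + 1).descFactorial (a + 1) : ℚ) * (β + 1).descFactorial (a + 1)) =
      (m.descFactorial (a + 1) : ℚ) * β.descFactorial (a + 1) +
        (a + 1) * (m + β + 1 - a) * ((m.descFactorial a : ℚ) * β.descFactorial a) := by
  have key : ∀ n : ℕ, (n.descFactorial (a + 1) : ℚ) = ((n : ℚ) - a) * n.descFactorial a := by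
    intro n
    rw [Nat.descFactorial_succ]
    rcases le_or_gt a n with h | h
    · push_cast [Nat.cast_sub h]; ring
    · simp [Nat.descFactorial_of_lt h]
  rw [Nat.succ_descFactorial_succ m a, Nat.succ_descFactorial_succ β a, key m, key β]
  push_cast
  ring

/-- With D = X₁X₄ - X₂X₃, the commutator of Ω^(j+1) and D on polynomials of degree d is
(j+1)(d+2-j)Ω^j. Since D vanishes at (1,1,1,1), only this commutator contributes to the value of
Ω^(j+1)(D·P) there. -/
theorem omegaCoeff_recurrence (m α γ β j : ℕ) :
    omegaCoeff (m + 1) α γ (β + 1) (j + 1) - omegaCoeff m (α + 1) (γ + 1) β (j + 1) =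
      (j + 1) * (m + α + γ + β + 2 - j) * omegaCoeff m α γ β j := by
  set u : ℕ → ℚ := fun a => (m.descFactorial a : ℚ) * β.descFactorial a with hu
  set v : ℕ → ℚ := fun a => (α.descFactorial a : ℚ) * γ.descFactorial a with hv
  have hu1 : ∀ a : ℕ, (((m + 1).descFactorial a : ℚ) * (β + 1).descFactorial a) =
      u a + a * (m + β + 2 - a) * u (a - 1) := by
    rintro (_ | a)
    · simp [hu]
    · rw [descFactorial_mul_descFactorial_succ]
      simp only [hu, Nat.add_sub_cancel]; push_cast; ring
  have hv1 : ∀ a : ℕ, (((α + 1).descFactorial a : ℚ) * (γ + 1).descFactorial a) =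
      v a + a * (α + γ + 2 - a) * v (a - 1) := by
    rintro (_ | a)
    · simp [hv]
    · rw [descFactorial_mul_descFactorial_succ]
      simp only [hv, Nat.add_sub_cancel]; push_cast; ring
  have h1 : omegaCoeff (m + 1) α γ (β + 1) (j + 1) - omegaCoeff m (α + 1) (γ + 1) β (j + 1) =
      ∑ q ∈ range (j + 2), (-1) ^ q * ((j + 1).choose q : ℚ) *
        ((j + 1 - q : ℕ) * (m + β + 2 - (j + 1 - q : ℕ)) * u (j + 1 - q - 1)) * v q -
      ∑ q ∈ range (j + 2), (-1) ^ q * ((j + 1).choose q : ℚ) *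
        u (j + 1 - q) * (q * (α + γ + 2 - q) * v (q - 1)) := by
    unfold omegaCoeff
    simp_rw [hu1, hv1]
    rw [← sum_sub_distrib, ← sum_sub_distrib]
    exact sum_congr rfl fun q _ => by simp only [hu, hv]; ring
  -- The factors `j + 1 - q` and `q` kill the last term of the first sum and the first term of the
  -- second. After the shift both sums run over `q ≤ j` and can be compared termwise.
  rw [h1, sum_range_succ, sum_range_succ' (n := j + 1)]
  simp only [Nat.sub_self, Nat.cast_zero, zero_mul, mul_zero, add_zero, ← sum_sub_distrib]
  unfold omegaCoeff
  rw [mul_sum]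
  refine sum_congr rfl fun q hq => ?_
  have hq' : q ≤ j := by simpa [Nat.lt_succ_iff] using hq
  have e1 : j + 1 - q - 1 = j - q := by omega
  have e2 : j + 1 - (q + 1) = j - q := by omega
  have e3 : ((j + 1 - q : ℕ) : ℚ) = j + 1 - q := by
    rw [Nat.cast_sub (by omega)]; push_cast; ring
  have c1 : ((j + 1).choose q : ℚ) * (j + 1 - q) = (j + 1) * j.choose q := by
    have := Nat.choose_mul_succ_eq j q
    have h2 : ((j.choose q * (j + 1) : ℕ) : ℚ) = (((j + 1).choose q * (j + 1 - q) : ℕ) : ℚ) := by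
      exact_mod_cast this
    push_cast at h2
    rw [e3] at h2
    linarith
  have c2 : ((j + 1).choose (q + 1) : ℚ) * (q + 1) = (j + 1) * j.choose q := by
    have := Nat.add_one_mul_choose_eq j q
    have h2 : (((j + 1) * j.choose q : ℕ) : ℚ) = (((j + 1).choose (q + 1) * (q + 1) : ℕ) : ℚ) := by
      exact_mod_cast this
    push_cast at h2
    linarith
  rw [e1, e2, e3]
  simp only [Nat.add_sub_cancel]
  push_cast
  change _ = (j + 1) * (m + α + γ + β + 2 - j) *
    ((-1) ^ q * (j.choose q : ℚ) * u (j - q) * v q)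
  rw [pow_succ]
  linear_combination ((-1) ^ q * (m + β + 2 - (j + 1 - q : ℚ)) * u (j - q) * v q) * c1 +
    ((-1) ^ q * (α + γ + 1 - q : ℚ) * u (j - q) * v q) * c2

/-- The four sums are the degrees in the rows and columns of the matrix with rows (X₁, X₂) and (X₃,
X₄); Ω lowers each of them by one. -/
theorem omegaCoeff_eq_zero {m α γ β j : ℕ}
    (h : m + α < j ∨ γ + β < j ∨ m + γ < j ∨ α + β < j) : omegaCoeff m α γ β j = 0 := by
  refine sum_eq_zero fun q hq => ?_
  have hq' : q ≤ j := by simpa [Nat.lt_succ_iff] using hq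
  have : m < j - q ∨ β < j - q ∨ α < q ∨ γ < q := by omega
  rcases this with h | h | h | h <;> simp [Nat.descFactorial_of_lt h]

-- Compare coefficients after applying ∂_x^a ∂_y^q to the binomial expansion of (x + y)^K.
open Polynomial in
theorem choose_mul_descFactorial_eq_coeff (K s a q : ℕ) :
    (K.choose s : ℚ) * s.descFactorial a * (K - s).descFactorial q =
      K.descFactorial (a + q) * (X ^ a * (1 + X) ^ (K - (a + q)) : ℚ[X]).coeff s := by
  rw [coeff_X_pow_mul', coeff_one_add_X_pow]
  split_ifs with h
  · by_cases h2 : a + q ≤ K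
    · by_cases h3 : s ≤ K
      · by_cases h4 : q ≤ K - s
        · obtain ⟨b, rfl⟩ := Nat.exists_eq_add_of_le h
          obtain ⟨c, hc⟩ := Nat.exists_eq_add_of_le h4
          obtain rfl : K = a + b + q + c := by omega
          have e1 : a + b + q + c - (a + b) = q + c := by omega
          have e2 : a + b + q + c - (a + q) = b + c := by omega
          rw [e1, e2, Nat.add_sub_cancel_left]
          have f1 : ((a + b + q + c).choose (a + b) : ℚ) * ((a + b).factorial * (q + c).factorial) =
              (a + b + q + c).factorial := by
            have := Nat.choose_mul_factorial_mul_factorial (show a + b ≤ a + b + q + c by omega)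
            rw [e1] at this
            rw [← mul_assoc]; exact_mod_cast this
          have f2 : ((b + c).choose b : ℚ) * (b.factorial * c.factorial) = (b + c).factorial := by
            have := Nat.choose_mul_factorial_mul_factorial (Nat.le_add_right b c)
            rw [Nat.add_sub_cancel_left] at this
            rw [← mul_assoc]; exact_mod_cast this
          have g1 : (b.factorial : ℚ) * (a + b).descFactorial a = (a + b).factorial := by
            have := Nat.factorial_mul_descFactorial (Nat.le_add_right a b)
            rw [Nat.add_sub_cancel_left] at this
            exact_mod_cast this
          have g2 : (c.factorial : ℚ) * (q + c).descFactorial q = (q + c).factorial := by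
            have := Nat.factorial_mul_descFactorial (Nat.le_add_right q c)
            rw [Nat.add_sub_cancel_left] at this
            exact_mod_cast this
          have g3 : ((b + c).factorial : ℚ) * (a + b + q + c).descFactorial (a + q) =
              (a + b + q + c).factorial := by
            have := Nat.factorial_mul_descFactorial h2
            rw [e2] at this
            exact_mod_cast this
          have nb : (b.factorial : ℚ) ≠ 0 := by positivity
          have nc : (c.factorial : ℚ) ≠ 0 := by positivity
          refine mul_right_cancel₀ (mul_ne_zero nb nc) ?_
          calc _ = ((a + b + q + c).choose (a + b) : ℚ) *
                ((b.factorial * (a + b).descFactorial a) *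
                  (c.factorial * (q + c).descFactorial q)) := by ring
            _ = _ := by
              rw [g1, g2, f1, ← g3, ← f2]; ring
        · rw [Nat.descFactorial_of_lt (not_le.1 h4),
            Nat.choose_eq_zero_of_lt (show K - (a + q) < s - a by omega)]
          simp
      · rw [Nat.choose_eq_zero_of_lt (not_le.1 h3),
          Nat.choose_eq_zero_of_lt (show K - (a + q) < s - a by omega)]
        simp
    · rw [Nat.descFactorial_of_lt (not_le.1 h2)]
      rcases le_or_gt s K with h3 | h3
      · rw [Nat.descFactorial_of_lt (show K - s < q by omega)]; simp
      · rw [Nat.choose_eq_zero_of_lt h3]; simp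
  · rw [Nat.descFactorial_of_lt (not_le.1 h)]; simp

/-- The weighted monomials sum to the coefficient of λ^T in (λX₁ + X₂)^K (λX₃ + X₄)^I, which Ω
annihilates because ∂₁∂₄ and ∂₂∂₃ act on it alike. Accordingly, each `q` contributes the same amount
up to the weight (-1)^q binom(j,q), and these weights sum to zero. -/
theorem sum_choose_mul_omegaCoeff (K I T j : ℕ) (hj : j ≠ 0) :
    ∑ s ∈ antidiagonal T, (K.choose s.1 : ℚ) * I.choose s.2 *
      omegaCoeff s.1 (K - s.1) s.2 (I - s.2) j = 0 := by
  unfold omegaCoeff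
  simp_rw [mul_sum]
  rw [sum_comm]
  have h : ∀ q ∈ range (j + 1), ∑ s ∈ antidiagonal T, (K.choose s.1 : ℚ) * I.choose s.2 *
      ((-1) ^ q * (j.choose q : ℚ) *
        ((s.1.descFactorial (j - q) : ℚ) * (I - s.2).descFactorial (j - q)) *
        (((K - s.1).descFactorial q : ℚ) * s.2.descFactorial q)) =
      (-1) ^ q * (j.choose q : ℚ) * (K.descFactorial j * I.descFactorial j *
        (Polynomial.X ^ j * (1 + Polynomial.X) ^ (K - j + (I - j)) : Polynomial ℚ).coeff T) := by
    intro q hq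
    have hq' : q ≤ j := by simpa [Nat.lt_succ_iff] using hq
    have e : (Polynomial.X ^ j * (1 + Polynomial.X) ^ (K - j + (I - j)) : Polynomial ℚ) =
        (Polynomial.X ^ (j - q) * (1 + Polynomial.X) ^ (K - j)) *
          (Polynomial.X ^ q * (1 + Polynomial.X) ^ (I - j)) := by
      conv_lhs => rw [show j = j - q + q by omega]
      rw [pow_add, pow_add, Nat.sub_add_cancel hq']; ring
    rw [e, Polynomial.coeff_mul, mul_sum, mul_sum]
    refine sum_congr rfl fun s _ => ?_
    have h1 := choose_mul_descFactorial_eq_coeff K s.1 (j - q) q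
    have h2 := choose_mul_descFactorial_eq_coeff I s.2 q (j - q)
    rw [show j - q + q = j by omega] at h1
    rw [show q + (j - q) = j by omega] at h2
    calc _ = (-1) ^ q * (j.choose q : ℚ) *
          (((K.choose s.1 : ℚ) * s.1.descFactorial (j - q) * (K - s.1).descFactorial q) *
          ((I.choose s.2 : ℚ) * s.2.descFactorial q * (I - s.2).descFactorial (j - q))) := by ring
      _ = _ := by rw [h1, h2]; ring
  rw [sum_congr rfl h, ← sum_mul]
  have := Int.alternating_sum_range_choose_of_ne hj
  have h2 : ∑ q ∈ range (j + 1), (-1 : ℚ) ^ q * (j.choose q : ℚ) = 0 := by exact_mod_cast this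
  rw [h2, zero_mul]

/-! ### The Gordan series of a monomial -/

/-- The coefficients of the Gordan series of the monomial `X₁^m X₂^α X₃^γ X₄^β`. -/
def gordanCoeff (m α γ β j : ℕ) : ℚ :=
  omegaCoeff m α γ β j / ((j.factorial : ℚ) ^ 2 * (m + α + γ + β - j + 1).choose j)

theorem gordanCoeff_zero (m α γ β : ℕ) : gordanCoeff m α γ β 0 = 1 := by
  simp [gordanCoeff, omegaCoeff_zero]

/-- The denominator of `gordanCoeff` is chosen to absorb the commutator factor; the bound on `j`
keeps the binomials in it nonzero. -/
theorem gordanCoeff_recurrence (m α γ β j : ℕ) (hj : 2 * j ≤ m + α + γ + β) :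
    gordanCoeff (m + 1) α γ (β + 1) (j + 1) - gordanCoeff m (α + 1) (γ + 1) β (j + 1) =
      gordanCoeff m α γ β j := by
  unfold gordanCoeff
  rw [show m + 1 + α + γ + (β + 1) - (j + 1) + 1 = (m + α + γ + β - j + 1) + 1 by omega,
    show m + (α + 1) + (γ + 1) + β - (j + 1) + 1 = (m + α + γ + β - j + 1) + 1 by omega,
    ← sub_div, omegaCoeff_recurrence]
  set n := m + α + γ + β - j + 1 with hn
  have hn' : (m + α + γ + β + 2 - j : ℚ) = n + 1 := by
    have : (m + α + γ + β : ℕ) + 1 = n + j := by omega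
    have h2 : ((m + α + γ + β + 1 : ℕ) : ℚ) = ((n + j : ℕ) : ℚ) := by exact_mod_cast this
    push_cast at h2
    linarith
  have c : ((n + 1).choose (j + 1) : ℚ) * (j + 1) = (n + 1) * n.choose j := by
    have h2 : (((n + 1) * n.choose j : ℕ) : ℚ) = (((n + 1).choose (j + 1) * (j + 1) : ℕ) : ℚ) := by
      exact_mod_cast Nat.add_one_mul_choose_eq n j
    push_cast at h2
    linarith
  have n1 : ((n + 1).choose (j + 1) : ℚ) ≠ 0 := by
    exact_mod_cast (Nat.choose_pos (by omega)).ne'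
  have n2 : (n.choose j : ℚ) ≠ 0 := by exact_mod_cast (Nat.choose_pos (by omega)).ne'
  have n3 : (j.factorial : ℚ) ≠ 0 := by positivity
  rw [hn', Nat.factorial_succ]
  push_cast
  have n4 : (j + 1 : ℚ) ≠ 0 := by positivity
  rw [div_eq_div_iff (by positivity) (by positivity)]
  linear_combination (-(j + 1 : ℚ) * omegaCoeff m α γ β j * (j.factorial : ℚ) ^ 2) * c

theorem gordanCoeff_eq_zero {m α γ β j : ℕ}
    (h : m + α < j ∨ γ + β < j ∨ m + γ < j ∨ α + β < j) : gordanCoeff m α γ β j = 0 := by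
  rw [gordanCoeff, omegaCoeff_eq_zero h, zero_div]

theorem sum_choose_mul_gordanCoeff (K I T j : ℕ) (hj : j ≠ 0) :
    ∑ s ∈ antidiagonal T, (K.choose s.1 : ℚ) * I.choose s.2 *
      gordanCoeff s.1 (K - s.1) s.2 (I - s.2) j = 0 := by
  have h : ∀ s ∈ antidiagonal T, (K.choose s.1 : ℚ) * I.choose s.2 *
      gordanCoeff s.1 (K - s.1) s.2 (I - s.2) j =
      ((K.choose s.1 : ℚ) * I.choose s.2 * omegaCoeff s.1 (K - s.1) s.2 (I - s.2) j) /
        ((j.factorial : ℚ) ^ 2 * (K + I - j + 1).choose j) := by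
    intro s _
    by_cases h1 : s.1 ≤ K
    · by_cases h2 : s.2 ≤ I
      · rw [gordanCoeff, show s.1 + (K - s.1) + s.2 + (I - s.2) = K + I by omega]; ring
      · simp [Nat.choose_eq_zero_of_lt (not_le.1 h2)]
    · simp [Nat.choose_eq_zero_of_lt (not_le.1 h1)]
  rw [sum_congr rfl h, ← sum_div, sum_choose_mul_omegaCoeff K I T j hj, zero_div]

/-- `binom (K + I) T` times the polarization of `X^K Y^I`, with `T` arguments `(b₀, c₀)` and
`K + I - T` arguments `(b₁, c₁)`. -/
noncomputable def polar (K I T : ℕ) (b₀ b₁ c₀ c₁ : ℂ) : ℂ :=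
  ∑ s ∈ antidiagonal T, (K.choose s.1 * b₀ ^ s.1 * b₁ ^ (K - s.1)) *
    (I.choose s.2 * c₀ ^ s.2 * c₁ ^ (I - s.2))

/-- The error term of the Gordan series of a monomial. -/
noncomputable def gordanError (b₀ b₁ c₀ c₁ : ℂ) (m α γ β : ℕ) : ℂ :=
  b₀ ^ m * b₁ ^ α * c₀ ^ γ * c₁ ^ β -
    ∑ j ∈ range (min (m + α) (γ + β) + 1), (gordanCoeff m α γ β j : ℂ) *
      (b₀ * c₁ - b₁ * c₀) ^ j *
      (polar (m + α - j) (γ + β - j) (m + γ - j) b₀ b₁ c₀ c₁ /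
        (m + α - j + (γ + β - j)).choose (m + γ - j))

/-- Monomial and series both obey this rule. For the series, multiplication by the determinant
shifts `j` to `j + 1`, and the two `j = 0` terms agree and cancel. -/
theorem gordanError_recurrence (b₀ b₁ c₀ c₁ : ℂ) (m α γ β : ℕ) :
    gordanError b₀ b₁ c₀ c₁ (m + 1) α γ (β + 1) - gordanError b₀ b₁ c₀ c₁ m (α + 1) (γ + 1) β =
      (b₀ * c₁ - b₁ * c₀) * gordanError b₀ b₁ c₀ c₁ m α γ β := by
  unfold gordanError
  rw [show min (m + 1 + α) (γ + (β + 1)) = min (m + α) (γ + β) + 1 by omega,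
    show min (m + (α + 1)) (γ + 1 + β) = min (m + α) (γ + β) + 1 by omega]
  rw [sum_range_succ' (n := min (m + α) (γ + β) + 1), sum_range_succ' (n := min (m + α) (γ + β) + 1),
    gordanCoeff_zero, gordanCoeff_zero,
    show m + (α + 1) = m + 1 + α by ring, show γ + 1 + β = γ + (β + 1) by ring,
    show m + (γ + 1) = m + 1 + γ by ring]
  have h : ∀ j ∈ range (min (m + α) (γ + β) + 1),
      (gordanCoeff (m + 1) α γ (β + 1) (j + 1) : ℂ) * (b₀ * c₁ - b₁ * c₀) ^ (j + 1) *
        (polar (m + 1 + α - (j + 1)) (γ + (β + 1) - (j + 1)) (m + 1 + γ - (j + 1)) b₀ b₁ c₀ c₁ /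
          (m + 1 + α - (j + 1) + (γ + (β + 1) - (j + 1))).choose (m + 1 + γ - (j + 1))) =
      (gordanCoeff m (α + 1) (γ + 1) β (j + 1) : ℂ) * (b₀ * c₁ - b₁ * c₀) ^ (j + 1) *
        (polar (m + 1 + α - (j + 1)) (γ + (β + 1) - (j + 1)) (m + 1 + γ - (j + 1)) b₀ b₁ c₀ c₁ /
          (m + 1 + α - (j + 1) + (γ + (β + 1) - (j + 1))).choose (m + 1 + γ - (j + 1))) +
      (b₀ * c₁ - b₁ * c₀) * ((gordanCoeff m α γ β j : ℂ) * (b₀ * c₁ - b₁ * c₀) ^ j *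
        (polar (m + α - j) (γ + β - j) (m + γ - j) b₀ b₁ c₀ c₁ /
        (m + α - j + (γ + β - j)).choose (m + γ - j))) := by
    intro j hj
    rw [mem_range] at hj
    rw [← gordanCoeff_recurrence m α γ β j (by omega),
      show m + 1 + α - (j + 1) = m + α - j by omega,
      show γ + (β + 1) - (j + 1) = γ + β - j by omega,
      show m + 1 + γ - (j + 1) = m + γ - j by omega]
    push_cast
    ring
  rw [sum_congr rfl h, sum_add_distrib, ← mul_sum]
  ring

/-- The weighted sum of the monomials is a polarization, and its series consists of the `j = 0` term
alone. -/
theorem sum_choose_mul_gordanError (b₀ b₁ c₀ c₁ : ℂ) (K I T : ℕ) (hT : T ≤ K + I) :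
    ∑ s ∈ antidiagonal T, (K.choose s.1 : ℂ) * I.choose s.2 *
      gordanError b₀ b₁ c₀ c₁ s.1 (K - s.1) s.2 (I - s.2) = 0 := by
  have h : ∀ s ∈ antidiagonal T, (K.choose s.1 : ℂ) * I.choose s.2 *
      gordanError b₀ b₁ c₀ c₁ s.1 (K - s.1) s.2 (I - s.2) =
      (K.choose s.1 * b₀ ^ s.1 * b₁ ^ (K - s.1)) * (I.choose s.2 * c₀ ^ s.2 * c₁ ^ (I - s.2)) -
      ∑ j ∈ range (min K I + 1), ((K.choose s.1 : ℂ) * I.choose s.2 *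
        (gordanCoeff s.1 (K - s.1) s.2 (I - s.2) j : ℂ)) * ((b₀ * c₁ - b₁ * c₀) ^ j *
        (polar (K - j) (I - j) (T - j) b₀ b₁ c₀ c₁ / (K - j + (I - j)).choose (T - j))) := by
    intro s hs
    by_cases h1 : s.1 ≤ K
    · by_cases h2 : s.2 ≤ I
      · rw [gordanError, Nat.add_sub_cancel' h1, Nat.add_sub_cancel' h2, HasAntidiagonal.mem_antidiagonal.1 hs,
          mul_sub, mul_sum]
        congr 1
        · ring
        · exact sum_congr rfl fun j _ => by ring
      · simp [Nat.choose_eq_zero_of_lt (not_le.1 h2)]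
    · simp [Nat.choose_eq_zero_of_lt (not_le.1 h1)]
  have hne : ((K + I).choose T : ℂ) ≠ 0 := by exact_mod_cast (Nat.choose_pos hT).ne'
  have hV : ∑ s ∈ antidiagonal T, ((K.choose s.1 : ℂ) * I.choose s.2) = (K + I).choose T := by
    rw [Nat.add_choose_eq]; push_cast; rfl
  have h0 : ∀ j ∈ range (min K I), (∑ s ∈ antidiagonal T, (K.choose s.1 : ℂ) * I.choose s.2 *
      (gordanCoeff s.1 (K - s.1) s.2 (I - s.2) (j + 1) : ℂ)) * ((b₀ * c₁ - b₁ * c₀) ^ (j + 1) *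
        (polar (K - (j + 1)) (I - (j + 1)) (T - (j + 1)) b₀ b₁ c₀ c₁ /
          (K - (j + 1) + (I - (j + 1))).choose (T - (j + 1)))) = 0 := by
    intro j _
    have := sum_choose_mul_gordanCoeff K I T (j + 1) (Nat.succ_ne_zero j)
    have h3 : ∑ s ∈ antidiagonal T, (K.choose s.1 : ℂ) * I.choose s.2 *
        (gordanCoeff s.1 (K - s.1) s.2 (I - s.2) (j + 1) : ℂ) = 0 := by exact_mod_cast this
    rw [h3, zero_mul]
  rw [sum_congr rfl h, sum_sub_distrib, sum_comm]
  simp_rw [← sum_mul]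
  rw [sum_range_succ' _ (min K I), sum_eq_zero h0]
  simp only [gordanCoeff_zero, Rat.cast_one, mul_one, pow_zero, one_mul, Nat.sub_zero, zero_add]
  rw [hV, mul_div_cancel₀ _ hne, polar, sub_self]

/-- Induction on the degree `m + α` in `b`. By the recurrence and the induction hypothesis the error
is the same for all monomials sharing their row and column degrees; a weighted sum of these errors
vanishes and the total weight is nonzero. -/
theorem gordanError_eq_zero (b₀ b₁ c₀ c₁ : ℂ) (m α γ β : ℕ) :
    gordanError b₀ b₁ c₀ c₁ m α γ β = 0 := by
  induction hK : m + α generalizing m α γ β with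
  | zero =>
    have hm : m = 0 := by omega
    have hα : α = 0 := by omega
    subst hm hα
    have hne : ((γ + β).choose γ : ℂ) ≠ 0 := by
      exact_mod_cast (Nat.choose_pos (Nat.le_add_right _ _)).ne'
    have hp : polar 0 (γ + β) γ b₀ b₁ c₀ c₁ = (γ + β).choose γ * c₀ ^ γ * c₁ ^ β := by
      rw [polar, sum_eq_single (0, γ)]
      · simp
      · rintro ⟨_ | s, s'⟩ hs hne
        · simp at hs; simp [hs] at hne
        · simp
      · simp
    simp [gordanError, gordanCoeff_zero, hp]
    field_simp
    ring
  | succ K ih =>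
    -- Replacing a factor X₁X₄ by X₂X₃ changes the error by a multiple of an error of lower degree,
    -- hence not at all.
    have chain : ∀ d m α γ β : ℕ, m + d + α = K + 1 →
        gordanError b₀ b₁ c₀ c₁ (m + d) α γ (β + d) =
          gordanError b₀ b₁ c₀ c₁ m (α + d) (γ + d) β := by
      intro d
      induction d with
      | zero => intros; rfl
      | succ d ihd =>
        intro m α γ β h
        have h1 := gordanError_recurrence b₀ b₁ c₀ c₁ (m + d) α γ (β + d)
        rw [ih (m + d) α γ (β + d) (by omega), mul_zero, sub_eq_zero] at h1
        rw [← add_assoc, ← add_assoc, h1, ihd m (α + 1) (γ + 1) β (by omega)]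
        congr 1 <;> ring
    have hT : m + γ ≤ (m + α) + (γ + β) := by omega
    have h := sum_choose_mul_gordanError b₀ b₁ c₀ c₁ (m + α) (γ + β) (m + γ) hT
    have hconst : ∀ s ∈ antidiagonal (m + γ), ((m + α).choose s.1 : ℂ) * (γ + β).choose s.2 *
        gordanError b₀ b₁ c₀ c₁ s.1 (m + α - s.1) s.2 (γ + β - s.2) =
        ((m + α).choose s.1 : ℂ) * (γ + β).choose s.2 * gordanError b₀ b₁ c₀ c₁ m α γ β := by
      rintro ⟨s, s'⟩ hs
      rw [HasAntidiagonal.mem_antidiagonal] at hs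
      simp only at hs ⊢
      by_cases h1 : s ≤ m + α
      · by_cases h2 : s' ≤ γ + β
        · congr 1
          rcases le_total m s with hms | hms
          · obtain ⟨d, rfl⟩ := Nat.exists_eq_add_of_le hms
            have := chain d m (m + α - (m + d)) s' β (by omega)
            rw [show γ + β - s' = β + d by omega, this]
            congr 1 <;> omega
          · obtain ⟨d, rfl⟩ := Nat.exists_eq_add_of_le hms
            have := chain d s α γ (γ + β - s') (by omega)
            rw [show γ + β - s' + d = β by omega] at this
            rw [this]
            congr 1 <;> omega
        · simp [Nat.choose_eq_zero_of_lt (not_le.1 h2)]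
      · simp [Nat.choose_eq_zero_of_lt (not_le.1 h1)]
    rw [sum_congr rfl hconst, ← sum_mul] at h
    have hV : ∑ s ∈ antidiagonal (m + γ), (((m + α).choose s.1 : ℂ) * (γ + β).choose s.2) =
        (m + α + (γ + β)).choose (m + γ) := by
      rw [Nat.add_choose_eq (m + α) (γ + β)]; push_cast; rfl
    rw [hV] at h
    have hne : ((m + α + (γ + β)).choose (m + γ) : ℂ) ≠ 0 := by
      exact_mod_cast (Nat.choose_pos hT).ne'
    exact (mul_eq_zero.1 h).resolve_left hne

/-! ### The associativity coefficients in terms of Gordan coefficients -/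

theorem binom_natCast (n k : ℕ) : binom n k = n.choose k := by
  simp [binom, Ring.choose_natCast]

theorem binom_of_neg (n : ℤ) {k : ℤ} (hk : k < 0) : binom n k = 0 := by
  simp [binom, not_le.2 hk]

theorem gordanCoeff_eq_sum (m α γ β j : ℕ) :
    gordanCoeff m α γ β j = ∑ q ∈ range (j + 1), (-1) ^ q * ((m.choose (j - q) : ℚ) *
      α.choose q * β.choose (j - q) * γ.choose q) /
        ((m + α + γ + β - j + 1).choose j * j.choose q) := by
  rw [gordanCoeff, omegaCoeff, sum_div]
  refine sum_congr rfl fun q hq => ?_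
  have hq' : q ≤ j := by simpa [Nat.lt_succ_iff] using hq
  have h : (j.choose q : ℚ) * q.factorial * (j - q).factorial = j.factorial := by
    exact_mod_cast Nat.choose_mul_factorial_mul_factorial hq'
  have n1 : (j.choose q : ℚ) ≠ 0 := by exact_mod_cast (Nat.choose_pos hq').ne'
  have n2 : (q.factorial : ℚ) ≠ 0 := by positivity
  have n3 : ((j - q).factorial : ℚ) ≠ 0 := by positivity
  simp only [Nat.descFactorial_eq_factorial_mul_choose, Nat.cast_mul, ← h]
  rcases eq_or_ne ((m + α + γ + β - j + 1).choose j : ℚ) 0 with h0 | h0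
  · simp [h0]
  · field_simp

/-- This explains the shape of F: `p` counts the vectors `c` inserted into factors of `b` when the
first product is polarized, the quotient of binomials is the weight of that term, and `M - p` is the
power of the determinant taken from the Gordan series. -/
theorem assocCoeff_eq_sum {i r k t m M : ℕ} (hr : m ≤ r) (hk : m ≤ k) (ht : t ≤ i)
    (hMk : M ≤ k) :
    assocCoeff i r k t m M = ∑ p ∈ range (M + 1), if p ≤ t then
      (-1) ^ (t - p) * ((k - m).choose p : ℚ) * (r - m).choose (t - p) / (r + k - 2 * m).choose t *
        gordanCoeff m (k - m - p) (t - p) (i - t) (M - p) else 0 := by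
  refine sum_congr rfl fun p hp => ?_
  have hp' : p ≤ M := by simpa [Nat.lt_succ_iff] using hp
  have e1 : (k - m : ℤ) = ((k - m : ℕ) : ℤ) := by omega
  have e2 : (r - m : ℤ) = ((r - m : ℕ) : ℤ) := by omega
  have e3 : (i - t : ℤ) = ((i - t : ℕ) : ℤ) := by omega
  have e4 : (k - 2 * m + r : ℤ) = ((r + k - 2 * m : ℕ) : ℤ) := by omega
  by_cases hpt : p ≤ t
  · by_cases hpk : p ≤ k - m
    · have e5 : (k - m - p : ℤ) = ((k - m - p : ℕ) : ℤ) := by omega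
      have e6 : (t - p : ℤ) = ((t - p : ℕ) : ℤ) := by omega
      have e7 : (M - p : ℤ) = ((M - p : ℕ) : ℤ) := by omega
      have e8 : (i + k - M - p + 1 : ℤ) =
          ((m + (k - m - p) + (t - p) + (i - t) - (M - p) + 1 : ℕ) : ℤ) := by omega
      rw [if_pos hpt, gordanCoeff_eq_sum, mul_sum]
      refine sum_congr rfl fun q hq => ?_
      have hq' : q ≤ M - p := by simpa [Nat.lt_succ_iff] using hq
      have e9 : (M - p - q : ℤ) = ((M - p - q : ℕ) : ℤ) := by omega
      rw [e9, e8, e7, e5, e6, e4, e3, e2, e1, zpow_add₀ (by norm_num), zpow_natCast, zpow_natCast]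
      simp only [binom_natCast]
      ring
    -- Here `k - m - p` is negative as an integer but truncated in ℕ; the factor binom(k-m, p) makes
    -- both sides zero.
    · rw [if_pos hpt, Nat.choose_eq_zero_of_lt (not_le.1 hpk)]
      refine (sum_eq_zero fun q _ => ?_).trans (by simp)
      rw [e1, binom_natCast, Nat.choose_eq_zero_of_lt (not_le.1 hpk)]
      simp
  · rw [if_neg hpt]
    refine sum_eq_zero fun q _ => ?_
    rw [binom_of_neg (r - m) (show (t - p : ℤ) < 0 by omega)]
    simp

/-- For each `p`, either one of the two binomial weights vanishes or the determinant power `M - p`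
exceeds a row or column degree of the monomial. -/
theorem assocCoeff_eq_zero {i r k t m M : ℕ} (hr : m ≤ r) (hk : m ≤ k) (ht : t ≤ i)
    (hMk : M ≤ k) (h : ¬ (M ≤ t + m ∧ t + m - M ≤ min r (k + i - 2 * M))) :
    assocCoeff i r k t m M = 0 := by
  rw [assocCoeff_eq_sum hr hk ht hMk]
  refine sum_eq_zero fun p hp => ?_
  have hp' : p ≤ M := by simpa [Nat.lt_succ_iff] using hp
  split_ifs with hpt
  · rcases le_or_gt p (k - m) with h1 | h1
    · rcases le_or_gt (t - p) (r - m) with h2 | h2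
      · rw [gordanCoeff_eq_zero (by omega), mul_zero]
      · simp [Nat.choose_eq_zero_of_lt h2]
    · simp [Nat.choose_eq_zero_of_lt h1]
  · rfl

/-! ### The scalar re-bracketing identity -/

theorem sum_range_range_eq {A : Type*} [AddCommMonoid A] (n : ℕ) (f : ℕ → ℕ → A) :
    ∑ M ∈ range (n + 1), ∑ p ∈ range (M + 1), f M p =
      ∑ p ∈ range (n + 1), ∑ j ∈ range (n - p + 1), f (p + j) p := by
  rw [sum_comm' (s' := fun p => Ico p (n + 1)) (t' := range (n + 1))]
  · refine sum_congr rfl fun p hp => ?_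
    rw [mem_range] at hp
    rw [sum_Ico_eq_sum_range, show n + 1 - p = n - p + 1 by omega]
  · intro x y
    simp only [mem_range, mem_Ico]
    omega

/-- The scalar identity behind the re-bracketing formula. The variables are the brackets of three
spinors `a, b, c` and an argument `x`. -/
theorem sum_assocCoeff_mul_polar {i r k t m : ℕ} (hr : m ≤ r) (hk : m ≤ k) (ht : t ≤ i)
    {ba bx ca cx bc ax : ℂ} (hD : bc * ax = ba * cx - bx * ca) :
    ba ^ m * (polar (k - m) (r - m) t bc bx (-ca) ax / (r + k - 2 * m).choose t) * cx ^ (i - t) =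
      ∑ M ∈ range (min i k + 1), (assocCoeff i r k t m M : ℂ) *
        (bc ^ M * ax ^ (r - (t + m - M)) * (polar (k - M) (i - M) (t + m - M) ba bx ca cx /
          (k - M + (i - M)).choose (t + m - M))) := by
  set Z : ℕ → ℂ := fun M => bc ^ M * ax ^ (r - (t + m - M)) *
    (polar (k - M) (i - M) (t + m - M) ba bx ca cx /
          (k - M + (i - M)).choose (t + m - M)) with hZ
  -- `g p` is the `p`-th term of the expanded left side, a multiple of (ba)^m (bx)^(k-m-p)
  -- (ca)^(t-p) (cx)^(i-t).
  set g : ℕ → ℂ := fun p => ba ^ m * (((k - m).choose p * bc ^ p * bx ^ (k - m - p)) *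
    ((r - m).choose (t - p) * (-ca) ^ (t - p) * ax ^ (r - m - (t - p))) /
      (r + k - 2 * m).choose t) * cx ^ (i - t) with hg
  have hR : ∑ M ∈ range (min i k + 1), (assocCoeff i r k t m M : ℂ) * Z M =
      ∑ M ∈ range (min i k + 1), ∑ p ∈ range (M + 1), (if p ≤ t then
        (-1) ^ (t - p) * ((k - m).choose p : ℂ) * (r - m).choose (t - p) /
          (r + k - 2 * m).choose t *
        (gordanCoeff m (k - m - p) (t - p) (i - t) (M - p) : ℂ) * Z M else 0) := by
    refine sum_congr rfl fun M hM => ?_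
    rw [mem_range] at hM
    rw [assocCoeff_eq_sum hr hk ht (by omega), Rat.cast_sum, sum_mul]
    refine sum_congr rfl fun p _ => ?_
    split_ifs
    · push_cast; rfl
    · simp
  -- For fixed `p`, the terms with `M = p + j` form the Gordan series of the monomial in `g p`, the
  -- determinant being `bc * ax` by `hD`.
  have hp : ∀ p ∈ range (min i k + 1), ∑ j ∈ range (min i k - p + 1), (if p ≤ t then
        (-1) ^ (t - p) * ((k - m).choose p : ℂ) * (r - m).choose (t - p) /
          (r + k - 2 * m).choose t *
        (gordanCoeff m (k - m - p) (t - p) (i - t) (p + j - p) : ℂ) * Z (p + j) else 0) =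
      if p ≤ t then g p else 0 := by
    intro p hp
    rw [mem_range] at hp
    split_ifs with hpt
    · rcases le_or_gt p (k - m) with h1 | h1
      · rcases le_or_gt (t - p) (r - m) with h2 | h2
        · have h := sub_eq_zero.1 (gordanError_eq_zero ba bx ca cx m (k - m - p) (t - p) (i - t))
          have hj : ∀ j ∈ range (min i k - p + 1),
              (-1) ^ (t - p) * ((k - m).choose p : ℂ) * (r - m).choose (t - p) /
                (r + k - 2 * m).choose t *
                (gordanCoeff m (k - m - p) (t - p) (i - t) (p + j - p) : ℂ) * Z (p + j) =
              (-1) ^ (t - p) * ((k - m).choose p : ℂ) * (r - m).choose (t - p) /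
                (r + k - 2 * m).choose t * (bc ^ p * ax ^ (r - m - (t - p))) *
              ((gordanCoeff m (k - m - p) (t - p) (i - t) j : ℂ) * (ba * cx - bx * ca) ^ j *
                (polar (m + (k - m - p) - j) (t - p + (i - t) - j) (m + (t - p) - j) ba bx ca cx /
                (m + (k - m - p) - j + (t - p + (i - t) - j)).choose (m + (t - p) - j))) := by
            intro j _
            rw [Nat.add_sub_cancel_left]
            rcases le_or_gt j (m + (t - p)) with h3 | h3
            · rw [← hD, hZ]
              simp only
              rw [show r - (t + m - (p + j)) = r - m - (t - p) + j by omega,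
                show m + (k - m - p) - j = k - (p + j) by omega,
                show t - p + (i - t) - j = i - (p + j) by omega,
                show m + (t - p) - j = t + m - (p + j) by omega, mul_pow, pow_add, pow_add]
              ring
            · rw [gordanCoeff_eq_zero (by omega)]; simp
          rw [sum_congr rfl hj, ← mul_sum,
            show min i k - p = min (m + (k - m - p)) (t - p + (i - t)) by omega, ← h, hg]
          simp only
          rw [neg_pow ca]
          ring
        · simp [hg, Nat.choose_eq_zero_of_lt h2]
      · simp [hg, Nat.choose_eq_zero_of_lt h1]
    · simp
  rw [hR, sum_range_range_eq, sum_congr rfl hp, ← sum_filter]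
  -- The added indices satisfy `p ≤ t ≤ i`, hence `p > k`, and their binomial vanishes.
  have hL : ∑ p ∈ range (min i k + 1) with p ≤ t, g p = ∑ p ∈ range (t + 1), g p := by
    refine sum_subset (fun p => by simp) fun p h1 h2 => ?_
    simp only [mem_filter, mem_range] at h1 h2
    simp [hg, Nat.choose_eq_zero_of_lt (show k - m < p by omega)]
  rw [hL, polar, Nat.sum_antidiagonal_eq_sum_range_succ_mk, sum_div, mul_sum, sum_mul]

/-! ### Polarization of symmetric multilinear maps -/

section Polarization

variable {U : Type*}

/-- The arguments `x, …, x, f 0, …, f (i - 1)` of an `n`-linear map. -/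
def tailArgs {n i : ℕ} (x : U) (f : Fin i → U) : Fin n → U := fun a =>
  if (a : ℕ) < n - i then x else if h : (a : ℕ) - (n - i) < i then f ⟨a - (n - i), h⟩ else x

theorem tailArgs_const {n i : ℕ} (hi : i ≤ n) (x y : U) :
    (tailArgs x (fun _ : Fin i => y) : Fin n → U) =
      fun a : Fin n => if (a : ℕ) < n - i then x else y := by
  funext a
  simp only [tailArgs]
  split_ifs <;> first | rfl | omega

theorem tailArgs_update {n i : ℕ} (hi : i ≤ n) [DecidableEq (Fin i)] (x : U) (f : Fin i → U)
    (c : Fin i) (z : U) : (tailArgs x (Function.update f c z) : Fin n → U) =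
      Function.update (tailArgs x f) ⟨n - i + c, by omega⟩ z := by
  funext a
  simp only [tailArgs, Function.update_apply, Fin.ext_iff]
  split_ifs <;> first | rfl | omega

theorem Contractible.fstArgs_const {k n i K : ℕ} (h : Contractible k n i K) (x : U)
    (f : Fin i → U) : h.fstArgs (fun _ => x) f = tailArgs x f := by
  funext a
  have := h.1
  simp only [Contractible.fstArgs, tailArgs]
  split_ifs <;> first | rfl | omega

theorem Contractible.sndArgs_const {k n i K : ℕ} (h : Contractible k n i K) (x : U)
    (f : Fin i → U) : h.sndArgs (fun _ => x) f = tailArgs x f := by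
  funext a
  have := h.2.1
  simp only [Contractible.sndArgs, tailArgs]
  split_ifs <;> first | rfl | omega

theorem prod_tailArgs {n i : ℕ} (hi : i ≤ n) (φ : U → ℂ) (x : U) (f : Fin i → U) :
    ∏ a : Fin n, φ (tailArgs x f a) = φ x ^ (n - i) * ∏ a, φ (f a) := by
  obtain ⟨d, rfl⟩ := Nat.exists_eq_add_of_le' hi
  rw [Fin.prod_univ_add]
  simp [tailArgs]

variable {E : Type*}

/-- Invariance of a function of `n` variables under permutations of the variables. -/
def IsSymm {n : ℕ} (g : (Fin n → U) → E) : Prop :=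
  ∀ (σ : Equiv.Perm (Fin n)) v, g (v ∘ σ) = g v

/-- Some permutation carries `s` onto the initial slots, so only its cardinality matters. -/
theorem IsSymm.piecewise {n : ℕ} {g : (Fin n → U) → E} (hg : IsSymm g) (x y : U)
    (s : Finset (Fin n)) :
    g (s.piecewise (fun _ => x) (fun _ => y)) = g (tailArgs x fun _ : Fin (n - s.card) => y) := by
  have hs : s.card ≤ n := by simpa using s.card_le_univ
  have hcard : Fintype.card {a : Fin n // (a : ℕ) < n - (n - s.card)} =
      Fintype.card {a // a ∈ s} := by
    rw [Fintype.card_subtype, Fintype.card_coe, Nat.sub_sub_self hs]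
    rcases hs.eq_or_lt with h | h
    · rw [h, filter_true_of_mem fun a _ => a.2]; simp
    · refine Eq.trans ?_ (Fin.card_Iio (⟨s.card, h⟩ : Fin n))
      congr 1
      ext a
      simp [Fin.lt_def]
  set e := Fintype.equivOfCardEq hcard
  rw [← hg e.extendSubtype, tailArgs_const (Nat.sub_le _ _)]
  congr 1
  funext a
  by_cases ha : (a : ℕ) < n - (n - s.card)
  · have := e.extendSubtype_mem a ha
    simp [this, ha]
  · have := e.extendSubtype_not_mem a ha
    simp [this, ha]

variable [AddCommGroup U] [Module ℂ U] [AddCommGroup E] [Module ℂ E]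

/-- A multilinear map as a function of its last arguments. -/
def tailMap {n i : ℕ} (hi : i ≤ n) (g : MultilinearMap ℂ (fun _ : Fin n => U) E) (x : U) :
    MultilinearMap ℂ (fun _ : Fin i => U) E where
  toFun f := g (tailArgs x f)
  map_update_add' := by
    intro _ f c y z
    simp only [tailArgs_update hi, MultilinearMap.map_update_add]
  map_update_smul' := by
    intro _ f c r y
    simp only [tailArgs_update hi, MultilinearMap.map_update_smul]

/-- Contraction with a power of a covector amounts to inserting one fixed vector into all contracted
slots. -/
theorem sum_prod_smul_tailArgs {n i : ℕ} (hi : i ≤ n)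
    (g : MultilinearMap ℂ (fun _ : Fin n => U) E) (x : U) (c : Fin 2 → ℂ) (u : Fin 2 → U) :
    ∑ B : Fin i → Fin 2, (∏ a, c (B a)) • g (tailArgs x fun a => u (B a)) =
      g (tailArgs x fun _ : Fin i => ∑ A, c A • u A) := by
  have h := (tailMap hi g x).map_sum (fun (_ : Fin i) (A : Fin 2) => c A • u A)
  simp only [MultilinearMap.map_smul_univ] at h
  exact h.symm

theorem IsSymm.apply_add_smul {n : ℕ} {g : MultilinearMap ℂ (fun _ : Fin n => U) ℂ}
    (hg : IsSymm g) (x y : U) (z : ℂ) :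
    g (fun _ => x + z • y) =
      ∑ t ∈ range (n + 1), n.choose t * g (tailArgs x fun _ : Fin t => y) * z ^ t := by
  have h := g.map_add_univ (fun _ => x) (fun _ => z • y)
  have h1 : ∀ s : Finset (Fin n), g (s.piecewise (fun _ => x) (fun _ => z • y)) =
      z ^ (n - s.card) * g (tailArgs x fun _ : Fin (n - s.card) => y) := by
    intro s
    rw [← hg.piecewise]
    have := g.map_piecewise_smul (fun _ => z) (s.piecewise (fun _ => x) (fun _ => y)) sᶜ
    rw [prod_const, card_compl, Fintype.card_fin] at this
    rw [← smul_eq_mul, ← this]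
    congr 1
    funext a
    by_cases ha : a ∈ s <;> simp [ha]
  have h2 : (fun _ : Fin n => x + z • y) = (fun _ => x) + fun _ => z • y := rfl
  rw [h2, h, sum_congr rfl fun s _ => h1 s, ← powerset_univ]
  rw [sum_powerset_apply_card (fun j => z ^ (n - j) * g (tailArgs x fun _ : Fin (n - j) => y)),
    card_univ, Fintype.card_fin, ← sum_range_reflect]
  refine sum_congr rfl fun t ht => ?_
  have ht' : t ≤ n := by simpa [Nat.lt_succ_iff] using ht
  rw [show n + 1 - 1 - t = n - t by omega, Nat.choose_symm ht', Nat.sub_sub_self ht', nsmul_eq_mul]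
  ring

open Polynomial in
/-- Polarization of a product of powers of two linear forms. -/
theorem IsSymm.apply_tailArgs_const {n t p q : ℕ} {g : MultilinearMap ℂ (fun _ : Fin n => U) ℂ}
    (hg : IsSymm g) (ht : t ≤ n) (α β : U →ₗ[ℂ] ℂ) (A : ℂ)
    (h : ∀ x, g (fun _ => x) = A * (α x ^ p * β x ^ q)) (x y : U) :
    g (tailArgs x fun _ : Fin t => y) =
      A * (polar p q t (α y) (α x) (β y) (β x) / n.choose t) := by
  -- Both sides are `g` on the diagonal at `x + z • y`, viewed as polynomials in `z`; the claim
  -- compares the coefficients of `z ^ t`.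
  have hp : (∑ t ∈ range (n + 1), C (n.choose t * g (tailArgs x fun _ : Fin t => y)) * X ^ t) =
      C A * ((C (α x) + C (α y) * X) ^ p * (C (β x) + C (β y) * X) ^ q) := by
    refine Polynomial.funext fun z => ?_
    have := h (x + z • y)
    rw [hg.apply_add_smul] at this
    simp only [eval_finsetSum, eval_mul, eval_C, eval_pow, eval_X, eval_add]
    rw [this]
    simp [mul_comm z]
  have hc : ∀ (a b : ℂ) (p s : ℕ), ((C a + C b * X) ^ p).coeff s =
      p.choose s * b ^ s * a ^ (p - s) := by
    intro a b p s
    rw [add_comm, add_pow, finsetSum_coeff]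
    have : ∀ j, ((C b * X) ^ j * C a ^ (p - j) * (p.choose j : ℂ[X])) =
        C (p.choose j * b ^ j * a ^ (p - j)) * X ^ j := by
      intro j
      simp only [map_mul, map_pow, map_natCast, mul_pow]
      ring
    simp_rw [this, coeff_C_mul_X_pow]
    rw [sum_ite_eq]
    split_ifs with hs
    · rfl
    · rw [Nat.choose_eq_zero_of_lt (by simpa using hs)]; simp
  have hco := congrArg (fun P => P.coeff t) hp
  simp only [finsetSum_coeff, coeff_C_mul, coeff_X_pow, mul_ite, mul_one, mul_zero] at hco
  simp only [coeff_mul, hc] at hco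
  rw [sum_ite_eq, if_pos (by simpa [Nat.lt_succ_iff] using ht)] at hco
  have hne : (n.choose t : ℂ) ≠ 0 := by exact_mod_cast (Nat.choose_pos ht).ne'
  rw [polar, mul_div_assoc', ← hco, mul_div_cancel_left₀ _ hne]

/-- In dimension two every tuple of basis vectors is, up to order, a block of one vector followed by
a block of the other, so polarization in two vectors suffices. -/
theorem IsSymm.eq_zero_of_const (e : SpinMetric U) {n : ℕ}
    {g : MultilinearMap ℂ (fun _ : Fin n => U) ℂ} (hg : IsSymm g) (h : ∀ x, g (fun _ => x) = 0) :
    g = 0 := by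
  refine Module.Basis.ext_multilinear (fun _ => e.basis) fun B => ?_
  have hB : (fun a => e.basis (B a)) = (univ.filter fun a => B a = 0).piecewise
      (fun _ => e.basis 0) (fun _ => e.basis 1) := by
    funext a
    by_cases ha : B a = 0
    · simp [ha]
    · simp [show B a = 1 by omega]
  rw [hB, hg.piecewise, hg.apply_tailArgs_const (p := 0) (q := 0) (Nat.sub_le _ _) 0 0 0
    (fun x => by simp [h x])]
  simp

end Polarization

/-! ### Bracket identities -/

namespace SpinMetric

variable {U : Type*} [AddCommGroup U] [Module ℂ U] (e : SpinMetric U)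

theorem form_swap (x y : U) : e.form x y = - e.form y x := (e.isAlt.neg_eq y x).symm

/-- The sign here, absent from `sum_form_basis_smul_dualBasis`, is the see-saw sign of spinor
contraction. -/
theorem sum_form_dualBasis_smul_basis (c : U) :
    ∑ A, e.form c (e.dualBasis A) • e.basis A = -c := by
  simp_rw [e.form_swap c, neg_smul]
  rw [sum_neg_distrib, e.basis_spec]

theorem sum_form_basis_smul_dualBasis (c : U) :
    ∑ A, e.form c (e.basis A) • e.dualBasis A = c := by
  rw [← sub_eq_zero]
  refine e.nondegenerate.1 _ fun y => ?_
  rw [← e.basis.sum_repr y]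
  simp only [map_sub, map_sum, map_smul, LinearMap.sub_apply, LinearMap.sum_apply,
    LinearMap.smul_apply, form_dualBasis, smul_eq_mul]
  simp

/-- In two dimensions the bracket is a multiple of the coordinate determinant, for which this is the
Plücker relation. -/
theorem plucker (a b c x : U) :
    e.form b c * e.form a x = e.form b a * e.form c x - e.form b x * e.form c a := by
  have h := fun u v => e.form_swap u v
  have key : ∀ u v : U, e.form u v = e.form (e.dualBasis 0) (e.dualBasis 1) *
      (e.form u (e.basis 0) * e.form v (e.basis 1) -
        e.form u (e.basis 1) * e.form v (e.basis 0)) := by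
    intro u v
    conv_lhs => rw [← e.sum_form_basis_smul_dualBasis u, ← e.sum_form_basis_smul_dualBasis v]
    simp only [Fin.sum_univ_two, map_add, map_smul, LinearMap.add_apply, LinearMap.smul_apply,
      smul_eq_mul, e.isAlt (e.dualBasis 0), e.isAlt (e.dualBasis 1),
      h (e.dualBasis 1) (e.dualBasis 0)]
    ring
  rw [key b c, key a x, key b a, key c x, key b x, key c a]
  ring

end SpinMetric

/-- The hypothesis makes `E` inject into the dual of `Z`, so dim E ≤ dim Z. -/
theorem Submodule.eq_top_of_forall_pairing {F E : Type*} [Field F] [AddCommGroup E] [Module F E]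
    [FiniteDimensional F E] {Z : Submodule F E} (T : E →ₗ[F] Module.Dual F E)
    (h : ∀ x, (∀ z ∈ Z, T x z = 0) → x = 0) : Z = ⊤ := by
  refine Submodule.eq_top_of_finrank_eq (le_antisymm (Submodule.finrank_le Z) ?_)
  rw [← Subspace.dual_finrank_eq (V := Z)]
  refine LinearMap.finrank_le_finrank_of_injective (f := Z.dualRestrict.comp T) ?_
  rw [injective_iff_map_eq_zero]
  exact fun x hx => h x fun z hz => LinearMap.congr_fun hx ⟨z, hz⟩

/-! ### Symmetric spinors and their products on constant arguments -/

namespace SymSpinor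

variable {V W : Type*} [AddCommGroup V] [Module ℂ V] [AddCommGroup W] [Module ℂ W] {k l : ℕ}

/-- Evaluation of a multilinear form at a fixed family of vectors. -/
def evalMap (w : Fin l → W) : MultilinearMap ℂ (fun _ : Fin l => W) ℂ →ₗ[ℂ] ℂ where
  toFun f := f w
  map_add' _ _ := rfl
  map_smul' _ _ := rfl

/-- A spinor with fixed primed arguments. -/
def evalRight (φ : SymSpinor V W k l) (w : Fin l → W) : MultilinearMap ℂ (fun _ : Fin k => V) ℂ :=
  (evalMap w).compMultilinearMap φ.1

theorem isSymm_evalRight (φ : SymSpinor V W k l) (w : Fin l → W) : IsSymm (evalRight φ w) :=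
  fun σ v => φ.2.1 σ v w

theorem isSymm_apply (φ : SymSpinor V W k l) (v : Fin k → V) : IsSymm (φ.1 v) :=
  fun σ w => φ.2.2 σ v w

end SymSpinor

namespace SpinSpace

variable {V W : Type*} [AddCommGroup V] [Module ℂ V] [AddCommGroup W] [Module ℂ W]
  (S : SpinSpace V W) {k l n m i j K L : ℕ}

/-- Polarization is applied to the unprimed slots, and then to the primed ones. -/
theorem ext_const (S : SpinSpace V W) {φ ψ : SymSpinor V W k l}
    (h : ∀ x y, φ.1 (fun _ => x) (fun _ => y) = ψ.1 (fun _ => x) (fun _ => y)) : φ = ψ := by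
  rw [← sub_eq_zero]
  set δ := φ - ψ with hδ
  have h0 : ∀ x y, δ.1 (fun _ => x) (fun _ => y) = 0 := by
    intro x y
    rw [hδ]
    simp [h]
  have h1 : ∀ y, SymSpinor.evalRight δ (fun _ => y) = 0 := fun y =>
    (SymSpinor.isSymm_evalRight δ _).eq_zero_of_const S.metric fun x => h0 x y
  have h2 : ∀ v, δ.1 v = 0 := fun v =>
    (SymSpinor.isSymm_apply δ v).eq_zero_of_const S.metricBar fun y => congrArg (fun g => g v) (h1 y)
  ext v w
  simp [h2]

theorem symProd_const (hK : Contractible k n i K) (hL : Contractible l m j L)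
    (φ : SymSpinor V W k l) (ψ : SymSpinor V W n m) (x : V) (y : W) :
    (S.symProd i j φ ψ : SymSpinor V W K L).1 (fun _ => x) (fun _ => y) =
      ∑ B : Fin i → Fin 2, ∑ B' : Fin j → Fin 2,
        φ.1 (tailArgs x fun a => S.metric.basis (B a))
          (tailArgs y fun a => S.metricBar.basis (B' a)) *
        ψ.1 (tailArgs x fun a => S.metric.dualBasis (B a))
          (tailArgs y fun a => S.metricBar.dualBasis (B' a)) := by
  rw [symProd, dif_pos ⟨hK, hL⟩, symmetrize_apply]
  have h : ∀ (σ : Equiv.Perm (Fin K)) (τ : Equiv.Perm (Fin L)),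
      S.contractMap hK hL φ ψ ((fun _ => x) ∘ σ) ((fun _ => y) ∘ τ) =
        S.contract hK hL φ ψ (fun _ => x) (fun _ => y) := fun _ _ => rfl
  simp only [h, sum_const, card_univ, Fintype.card_perm, Fintype.card_fin, nsmul_eq_mul]
  have n1 : (K.factorial : ℂ) ≠ 0 := by exact_mod_cast K.factorial_ne_zero
  have n2 : (L.factorial : ℂ) ≠ 0 := by exact_mod_cast L.factorial_ne_zero
  simp only [contract, hK.fstArgs_const, hK.sndArgs_const, hL.fstArgs_const, hL.sndArgs_const]
  field_simp

theorem symProd_of_not (h : ¬ (Contractible k n i K ∧ Contractible l m j L))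
    (φ : SymSpinor V W k l) (ψ : SymSpinor V W n m) :
    (S.symProd i j φ ψ : SymSpinor V W K L) = 0 := dif_neg h

/-- The symmetric product as a bilinear map. -/
noncomputable def symProdₗ (k l n m i j K L : ℕ) :
    SymSpinor V W k l →ₗ[ℂ] SymSpinor V W n m →ₗ[ℂ] SymSpinor V W K L :=
  LinearMap.mk₂ ℂ (fun φ ψ => S.symProd i j φ ψ)
    (by
      intro φ φ' ψ
      by_cases h : Contractible k n i K ∧ Contractible l m j L
      · refine S.ext_const fun x y => ?_
        simp [S.symProd_const h.1 h.2, add_mul, sum_add_distrib]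
      · simp [S.symProd_of_not h])
    (by
      intro c φ ψ
      by_cases h : Contractible k n i K ∧ Contractible l m j L
      · refine S.ext_const fun x y => ?_
        simp [S.symProd_const h.1 h.2, mul_sum, mul_assoc]
      · simp [S.symProd_of_not h])
    (by
      intro φ ψ ψ'
      by_cases h : Contractible k n i K ∧ Contractible l m j L
      · refine S.ext_const fun x y => ?_
        simp [S.symProd_const h.1 h.2, mul_add, sum_add_distrib]
      · simp [S.symProd_of_not h])
    (by
      intro c φ ψ
      by_cases h : Contractible k n i K ∧ Contractible l m j L
      · refine S.ext_const fun x y => ?_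
        simp [S.symProd_const h.1 h.2, mul_sum, mul_left_comm]
      · simp [S.symProd_of_not h])

theorem symProdₗ_apply (φ : SymSpinor V W k l) (ψ : SymSpinor V W n m) :
    S.symProdₗ k l n m i j K L φ ψ = S.symProd i j φ ψ := rfl

/-! ### Powers of spinors -/

/-- The power `a_{A₁}⋯a_{A_k} b_{A'₁}⋯b_{A'_l}` of a pair of spinors. -/
noncomputable def powSpinor (k l : ℕ) (a : V) (b : W) : SymSpinor V W k l where
  val := ((MultilinearMap.mkPiAlgebra ℂ (Fin k) ℂ).compLinearMap
      fun _ => S.metric.form a).smulRight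
    ((MultilinearMap.mkPiAlgebra ℂ (Fin l) ℂ).compLinearMap fun _ => S.metricBar.form b)
  property := by
    constructor
    · intro σ v w
      simp [Equiv.prod_comp σ fun c => S.metric.form a (v c)]
    · intro σ v w
      simp [Equiv.prod_comp σ fun c => S.metricBar.form b (w c)]

theorem powSpinor_apply (a : V) (b : W) (v : Fin k → V) (w : Fin l → W) :
    (S.powSpinor k l a b).1 v w =
      (∏ c, S.metric.form a (v c)) * ∏ c, S.metricBar.form b (w c) := by
  simp [powSpinor]

theorem symProd_powSpinor_right_const (hK : Contractible k n i K) (hL : Contractible l m j L)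
    (φ : SymSpinor V W k l) (c : V) (d : W) (x : V) (y : W) :
    (S.symProd i j φ (S.powSpinor n m c d) : SymSpinor V W K L).1 (fun _ => x) (fun _ => y) =
      (-1) ^ (i + j) * φ.1 (tailArgs x fun _ : Fin i => c) (tailArgs y fun _ : Fin j => d) *
        (S.metric.form c x ^ (n - i) * S.metricBar.form d y ^ (m - j)) := by
  rw [S.symProd_const hK hL]
  simp only [powSpinor_apply, prod_tailArgs hK.2.1 (S.metric.form c),
    prod_tailArgs hL.2.1 (S.metricBar.form d)]
  have h1 := sum_prod_smul_tailArgs hK.1 φ.1 x (fun A => S.metric.form c (S.metric.dualBasis A))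
    S.metric.basis
  have h2 := fun v => sum_prod_smul_tailArgs hL.1 (φ.1 v) y
    (fun A => S.metricBar.form d (S.metricBar.dualBasis A)) S.metricBar.basis
  simp only [SpinMetric.sum_form_dualBasis_smul_basis] at h1 h2
  have h3 := (tailMap hK.1 φ.1 x).map_smul_univ (fun _ => (-1 : ℂ)) fun _ => c
  have h4 := fun v => (tailMap hL.1 (φ.1 v) y).map_smul_univ (fun _ => (-1 : ℂ)) fun _ => d
  simp only [neg_one_smul, prod_const, card_univ, Fintype.card_fin, smul_eq_mul] at h3 h4
  change φ.1 (tailArgs x fun _ => -c) = (-1 : ℂ) ^ i • φ.1 (tailArgs x fun _ => c) at h3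
  change ∀ v, φ.1 v (tailArgs y fun _ => -d) = (-1 : ℂ) ^ j * φ.1 v (tailArgs y fun _ => d) at h4
  have h5 := congrArg (fun f => f (tailArgs y fun _ : Fin j => -d)) (h1.trans h3)
  simp only [_root_.sum_apply, _root_.smul_apply, smul_eq_mul, h4] at h5
  simp only [h4, smul_eq_mul] at h2
  rw [show ∀ P Q R : ℂ, (-1) ^ (i + j) * P * (Q * R) = ((-1) ^ i * ((-1) ^ j * P)) * (Q * R) by
    intros; ring, ← h5, sum_mul]
  refine sum_congr rfl fun B _ => ?_
  rw [← h2, mul_sum, sum_mul]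
  exact sum_congr rfl fun B' _ => by ring

theorem symProd_powSpinor_left_const (hK : Contractible k n i K) (hL : Contractible l m j L)
    (φ : SymSpinor V W n m) (a : V) (b : W) (x : V) (y : W) :
    (S.symProd i j (S.powSpinor k l a b) φ : SymSpinor V W K L).1 (fun _ => x) (fun _ => y) =
      S.metric.form a x ^ (k - i) * S.metricBar.form b y ^ (l - j) *
        φ.1 (tailArgs x fun _ : Fin i => a) (tailArgs y fun _ : Fin j => b) := by
  rw [S.symProd_const hK hL]
  simp only [powSpinor_apply, prod_tailArgs hK.1 (S.metric.form a),
    prod_tailArgs hL.1 (S.metricBar.form b)]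
  have h1 := sum_prod_smul_tailArgs hK.2.1 φ.1 x (fun A => S.metric.form a (S.metric.basis A))
    S.metric.dualBasis
  have h2 := fun v => sum_prod_smul_tailArgs hL.2.1 (φ.1 v) y
    (fun A => S.metricBar.form b (S.metricBar.basis A)) S.metricBar.dualBasis
  simp only [SpinMetric.sum_form_basis_smul_dualBasis] at h1 h2
  have h5 := congrArg (fun f => f (tailArgs y fun _ : Fin j => b)) h1
  simp only [_root_.sum_apply, _root_.smul_apply, smul_eq_mul] at h5
  simp only [smul_eq_mul] at h2
  rw [← h5, mul_sum]
  refine sum_congr rfl fun B _ => ?_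
  rw [← h2, mul_sum, mul_sum]
  exact sum_congr rfl fun B' _ => by ring

theorem symProd_powSpinor_powSpinor_const (hK : Contractible k n i K) (hL : Contractible l m j L)
    (a c : V) (b d : W) (x : V) (y : W) :
    (S.symProd i j (S.powSpinor k l a b) (S.powSpinor n m c d) : SymSpinor V W K L).1
        (fun _ => x) (fun _ => y) =
      (S.metric.form c a ^ i * (S.metric.form c x ^ (n - i) * S.metric.form a x ^ (k - i))) *
        (S.metricBar.form d b ^ j *
          (S.metricBar.form d y ^ (m - j) * S.metricBar.form b y ^ (l - j))) := by
  rw [S.symProd_powSpinor_left_const hK hL, powSpinor_apply,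
    prod_tailArgs hK.2.1 (S.metric.form c), prod_tailArgs hL.2.1 (S.metricBar.form d)]
  simp only [prod_const, card_univ, Fintype.card_fin]
  ring

/-- The full contraction of two spinors of the same valence. -/
noncomputable def pairing (k l : ℕ) : SymSpinor V W k l →ₗ[ℂ] Module.Dual ℂ (SymSpinor V W k l) :=
  (S.symProdₗ k l k l k l 0 0).compr₂
    { toFun := fun f => f.1 (fun _ => 0) (fun _ => 0)
      map_add' := fun _ _ => rfl
      map_smul' := fun _ _ => rfl }

theorem pairing_powSpinor (φ : SymSpinor V W k l) (x : V) (y : W) :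
    S.pairing k l φ (S.powSpinor k l x y) = (-1) ^ (k + l) * φ.1 (fun _ => x) (fun _ => y) := by
  change (S.symProd k l φ (S.powSpinor k l x y) : SymSpinor V W 0 0).1
    (fun _ => 0) (fun _ => 0) = _
  rw [S.symProd_powSpinor_right_const ⟨le_rfl, le_rfl, by omega⟩ ⟨le_rfl, le_rfl, by omega⟩,
    tailArgs_const le_rfl, tailArgs_const le_rfl]
  simp

theorem finiteDimensional_symSpinor (S : SpinSpace V W) :
    FiniteDimensional ℂ (SymSpinor V W k l) := by
  have := S.metric.finiteDimensional
  have := S.metricBar.finiteDimensional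
  infer_instance

/-- A spinor whose full contraction with every power vanishes is zero on constant arguments, by
`pairing_powSpinor`, hence zero. -/
theorem span_powSpinor :
    Submodule.span ℂ (Set.range fun p : V × W => S.powSpinor k l p.1 p.2) = ⊤ := by
  have := S.finiteDimensional_symSpinor (k := k) (l := l)
  refine Submodule.eq_top_of_forall_pairing (F := ℂ) (E := SymSpinor V W k l) (S.pairing k l)
    fun φ hφ => ?_
  refine S.ext_const fun x y => ?_
  have h := hφ (S.powSpinor k l x y) (Submodule.subset_span ⟨(x, y), rfl⟩)
  rw [pairing_powSpinor] at h
  simpa using h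

theorem induction_powSpinor {p : SymSpinor V W k l → Prop}
    (pow : ∀ a b, p (S.powSpinor k l a b)) (zero : p 0)
    (add : ∀ φ ψ, p φ → p ψ → p (φ + ψ)) (smul : ∀ (c : ℂ) φ, p φ → p (c • φ))
    (φ : SymSpinor V W k l) : p φ := by
  have h : φ ∈ Submodule.span ℂ (Set.range fun p : V × W => S.powSpinor k l p.1 p.2) := by
    rw [S.span_powSpinor]; trivial
  induction h using Submodule.span_induction with
  | mem φ h => obtain ⟨q, rfl⟩ := h; exact pow _ _
  | zero => exact zero
  | add φ ψ _ _ h1 h2 => exact add φ ψ h1 h2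
  | smul c φ _ h => exact smul c φ h

end SpinSpace

/-! ### Products of powers and graded anti-commutativity -/

theorem polar_comm (K I T : ℕ) (b₀ b₁ c₀ c₁ : ℂ) :
    polar K I T b₀ b₁ c₀ c₁ = polar I K T c₀ c₁ b₀ b₁ := by
  rw [polar, polar, ← Nat.sum_antidiagonal_swap]
  exact sum_congr rfl fun s _ => mul_comm _ _

namespace SpinSpace

variable {V W : Type*} [AddCommGroup V] [Module ℂ V] [AddCommGroup W] [Module ℂ W]
  (S : SpinSpace V W) {k l n m i j K L : ℕ}

/-- On constant arguments the product is a product of powers of two linear forms in `x` and of two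
in `y`; each pair is polarized separately. This evaluates a product that is itself a factor of
another product. -/
theorem symProd_powSpinor_powSpinor_tailArgs (hK : Contractible k n i K)
    (hL : Contractible l m j L) {t u : ℕ} (ht : t ≤ K) (hu : u ≤ L)
    (a c : V) (b d : W) (x z : V) (y z' : W) :
    (S.symProd i j (S.powSpinor k l a b) (S.powSpinor n m c d) : SymSpinor V W K L).1
        (tailArgs x fun _ : Fin t => z) (tailArgs y fun _ : Fin u => z') =
      (S.metric.form c a ^ i * (polar (n - i) (k - i) t (S.metric.form c z) (S.metric.form c x)
        (S.metric.form a z) (S.metric.form a x) / K.choose t)) *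
      (S.metricBar.form d b ^ j * (polar (m - j) (l - j) u (S.metricBar.form d z')
        (S.metricBar.form d y) (S.metricBar.form b z') (S.metricBar.form b y) / L.choose u)) := by
  set χ : SymSpinor V W K L := S.symProd i j (S.powSpinor k l a b) (S.powSpinor n m c d) with hχ
  have h1 : ∀ y, χ.1 (tailArgs x fun _ : Fin t => z) (fun _ => y) = _ := fun y =>
    (SymSpinor.isSymm_evalRight χ fun _ => y).apply_tailArgs_const ht
      (S.metric.form c) (S.metric.form a) (S.metric.form c a ^ i * (S.metricBar.form d b ^ j *
        (S.metricBar.form d y ^ (m - j) * S.metricBar.form b y ^ (l - j))))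
      (p := n - i) (q := k - i) (fun x => by
        refine (S.symProd_powSpinor_powSpinor_const hK hL a c b d x y).trans ?_
        ring) x z
  rw [(SymSpinor.isSymm_apply χ _).apply_tailArgs_const hu (S.metricBar.form d)
      (S.metricBar.form b) (S.metric.form c a ^ i * (polar (n - i) (k - i) t (S.metric.form c z)
        (S.metric.form c x) (S.metric.form a z) (S.metric.form a x) / K.choose t) *
        S.metricBar.form d b ^ j) (p := m - j) (q := l - j) (fun y => by rw [h1 y]; ring) y z']
  ring

theorem symProd_comm {i j r s m n : ℕ} (hm : m ≤ min i r) (hn : n ≤ min j s)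
    (φ : SymSpinor V W i j) (ω : SymSpinor V W r s) :
    (S.symProd m n φ ω : SymSpinor V W (i + r - 2 * m) (j + s - 2 * n)) =
      (-1 : ℂ) ^ (m + n) • S.symProd m n ω φ := by
  simp only [← symProdₗ_apply]
  induction φ using S.induction_powSpinor with
  | zero => simp
  | add φ ψ h1 h2 => simp [h1, h2]
  | smul c φ h => simp [h, smul_comm c]
  | pow a b =>
    induction ω using S.induction_powSpinor with
    | zero => simp
    | add φ ψ h1 h2 => simp [h1, h2]
    | smul c φ h => simp [h, smul_comm c]
    | pow c d =>
      refine S.ext_const fun x y => ?_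
      simp only [symProdₗ_apply, Submodule.coe_smul, _root_.smul_apply, smul_eq_mul]
      rw [S.symProd_powSpinor_powSpinor_const ⟨by omega, by omega, by omega⟩
        ⟨by omega, by omega, by omega⟩, S.symProd_powSpinor_powSpinor_const
        ⟨by omega, by omega, by omega⟩ ⟨by omega, by omega, by omega⟩,
        S.metric.form_swap c a, S.metricBar.form_swap d b, neg_pow (S.metric.form a c),
        neg_pow (S.metricBar.form b d)]
      ring

theorem sum_sum_smul_const {s s' : Finset ℕ} {c : ℕ → ℕ → ℂ} {X : ℕ → ℕ → SymSpinor V W K L}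
    {x : V} {y : W} {z : ℂ} {p q : ℕ → ℂ} (h : ∀ M ∈ s, ∀ N ∈ s',
      c M N * (X M N).1 (fun _ => x) (fun _ => y) = z * (p M * q N)) :
    (∑ M ∈ s, ∑ N ∈ s', c M N • X M N).1 (fun _ => x) (fun _ => y) =
      z * ((∑ M ∈ s, p M) * ∑ N ∈ s', q N) := by
  simp only [Submodule.coe_sum, _root_.sum_apply, Submodule.coe_smul, _root_.smul_apply,
    smul_eq_mul]
  rw [sum_mul_sum, mul_sum]
  refine sum_congr rfl fun M hM => ?_
  rw [mul_sum]
  exact sum_congr rfl fun N hN => h M hM N hN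

end SpinSpace

/-! ### The re-bracketing formula -/

/-- The `M`-th term of the re-bracketing formula for powers of `a, b, c`, evaluated at `x`. -/
noncomputable def SpinMetric.assocTerm {U : Type*} [AddCommGroup U] [Module ℂ U]
    (e : SpinMetric U) (i r k t m M : ℕ) (a b c x : U) : ℂ :=
  (assocCoeff i r k t m M : ℂ) * (e.form b c ^ M * e.form a x ^ (r - (t + m - M)) *
    (polar (k - M) (i - M) (t + m - M) (e.form b a) (e.form b x) (e.form c a) (e.form c x) /
      (k - M + (i - M)).choose (t + m - M)))

namespace SpinSpace

variable {V W : Type*} [AddCommGroup V] [Module ℂ V] [AddCommGroup W] [Module ℂ W]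
  (S : SpinSpace V W) {k l n m i j K L : ℕ}

/-- The sign (-1)^(M+N) turns the brackets (cb) of the product into (bc). If the outer product is
out of range, a coefficient vanishes on both sides. -/
theorem assocCoeff_mul_symProd_powSpinor_const {i j r s k l m n t u M N : ℕ} (hm : m ≤ min r k)
    (hn : n ≤ min s l) (ht : t ≤ min (r + k - 2 * m) i) (hu : u ≤ min (s + l - 2 * n) j)
    (hM : M ≤ min i k) (hN : N ≤ min j l) (a b c x : V) (a' b' c' y : W) :
    ((-1 : ℂ) ^ (t + u + M + N) *
        (assocCoeff i r k t m M : ℂ) * (assocCoeff j s l u n N : ℂ)) *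
      (S.symProd (t + m - M) (u + n - N) (S.powSpinor r s a a')
        (S.symProd M N (S.powSpinor k l b b') (S.powSpinor i j c c') :
          SymSpinor V W (k + i - 2 * M) (l + j - 2 * N)) :
        SymSpinor V W (r + k - 2 * m + i - 2 * t) (s + l - 2 * n + j - 2 * u)).1
        (fun _ => x) (fun _ => y) =
      (-1) ^ (t + u) * (S.metric.assocTerm i r k t m M a b c x *
        S.metricBar.assocTerm j s l u n N a' b' c' y) := by
  unfold SpinMetric.assocTerm
  by_cases h1 : M ≤ t + m ∧ t + m - M ≤ min r (k + i - 2 * M)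
  · by_cases h2 : N ≤ u + n ∧ u + n - N ≤ min s (l + j - 2 * N)
    · rw [S.symProd_powSpinor_left_const ⟨by omega, by omega, by omega⟩
        ⟨by omega, by omega, by omega⟩, S.symProd_powSpinor_powSpinor_tailArgs
        ⟨by omega, by omega, by omega⟩ ⟨by omega, by omega, by omega⟩ (by omega) (by omega),
        polar_comm (i - M), polar_comm (j - N),
        show k - M + (i - M) = k + i - 2 * M by omega,
        show l - N + (j - N) = l + j - 2 * N by omega,
        S.metric.form_swap b c, S.metricBar.form_swap b' c', neg_pow (S.metric.form c b),
        neg_pow (S.metricBar.form c' b')]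
      ring
    · rw [assocCoeff_eq_zero (hn.trans (min_le_left _ _)) (hn.trans (min_le_right _ _))
        (hu.trans (min_le_right _ _)) (hN.trans (min_le_right _ _)) h2]
      simp
  · rw [assocCoeff_eq_zero (hm.trans (min_le_left _ _)) (hm.trans (min_le_right _ _))
      (ht.trans (min_le_right _ _)) (hM.trans (min_le_right _ _)) h1]
    simp

/-- The double sum factors into an unprimed and a primed sum, and each is the scalar identity with
`hD` supplied by `plucker`. The common sign (-1)^(t+u) is that of contracting with a power on the
right. -/
theorem symProd_powSpinor_assoc {i j r s k l m n t u : ℕ} (hm : m ≤ min r k) (hn : n ≤ min s l)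
    (ht : t ≤ min (r + k - 2 * m) i) (hu : u ≤ min (s + l - 2 * n) j) (a b c : V) (a' b' c' : W) :
    (S.symProd t u
        (S.symProd m n (S.powSpinor r s a a') (S.powSpinor k l b b') :
          SymSpinor V W (r + k - 2 * m) (s + l - 2 * n)) (S.powSpinor i j c c') :
      SymSpinor V W (r + k - 2 * m + i - 2 * t) (s + l - 2 * n + j - 2 * u)) =
      ∑ M ∈ range (min i k + 1), ∑ N ∈ range (min j l + 1),
        ((-1 : ℂ) ^ (t + u + M + N) *
            (assocCoeff i r k t m M : ℂ) * (assocCoeff j s l u n N : ℂ)) •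
          S.symProd (t + m - M) (u + n - N) (S.powSpinor r s a a')
            (S.symProd M N (S.powSpinor k l b b') (S.powSpinor i j c c') :
              SymSpinor V W (k + i - 2 * M) (l + j - 2 * N)) := by
  refine S.ext_const fun x y => ?_
  rw [sum_sum_smul_const fun M hM N hN =>
    S.assocCoeff_mul_symProd_powSpinor_const hm hn ht hu (Nat.lt_succ_iff.1 (mem_range.1 hM))
      (Nat.lt_succ_iff.1 (mem_range.1 hN)) a b c x a' b' c' y]
  unfold SpinMetric.assocTerm
  rw [S.symProd_powSpinor_right_const ⟨by omega, by omega, by omega⟩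
    ⟨by omega, by omega, by omega⟩, S.symProd_powSpinor_powSpinor_tailArgs
    ⟨by omega, by omega, by omega⟩ ⟨by omega, by omega, by omega⟩ (by omega) (by omega),
    ← sum_assocCoeff_mul_polar (by omega) (by omega) (by omega) (S.metric.plucker a b c x),
    ← sum_assocCoeff_mul_polar (by omega) (by omega) (by omega) (S.metricBar.plucker a' b' c' y),
    ← S.metric.form_swap a c, ← S.metricBar.form_swap a' c']
  ring

theorem symProd_assoc {i j r s k l m n t u : ℕ} (hm : m ≤ min r k) (hn : n ≤ min s l)
    (ht : t ≤ min (r + k - 2 * m) i) (hu : u ≤ min (s + l - 2 * n) j)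
    (ω : SymSpinor V W r s) (φ : SymSpinor V W k l) (ϕ : SymSpinor V W i j) :
    (S.symProd t u
        (S.symProd m n ω φ : SymSpinor V W (r + k - 2 * m) (s + l - 2 * n)) ϕ :
      SymSpinor V W (r + k - 2 * m + i - 2 * t) (s + l - 2 * n + j - 2 * u)) =
      ∑ M ∈ range (min i k + 1), ∑ N ∈ range (min j l + 1),
        ((-1 : ℂ) ^ (t + u + M + N) *
            (assocCoeff i r k t m M : ℂ) * (assocCoeff j s l u n N : ℂ)) •
          S.symProd (t + m - M) (u + n - N) ω
            (S.symProd M N φ ϕ : SymSpinor V W (k + i - 2 * M) (l + j - 2 * N)) := by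
  simp only [← symProdₗ_apply]
  induction ω using S.induction_powSpinor with
  | zero => simp
  | add φ ψ h1 h2 => simp only [map_add, LinearMap.add_apply, h1, h2, smul_add, sum_add_distrib]
  | smul c φ h => simp only [map_smul, LinearMap.smul_apply, h, smul_sum, smul_comm c]
  | pow a a' =>
    induction φ using S.induction_powSpinor with
    | zero => simp
    | add φ ψ h1 h2 => simp only [map_add, LinearMap.add_apply, h1, h2, smul_add, sum_add_distrib]
    | smul c φ h => simp only [map_smul, LinearMap.smul_apply, h, smul_sum, smul_comm c]
    | pow b b' =>
      induction ϕ using S.induction_powSpinor with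
      | zero => simp
      | add φ ψ h1 h2 => simp only [map_add, h1, h2, smul_add, sum_add_distrib]
      | smul c φ h => simp only [map_smul, h, smul_sum, smul_comm c]
      | pow c c' => exact S.symProd_powSpinor_assoc hm hn ht hu a b c a' b' c'

/-! ### Conjugation -/

theorem bar_add (φ ψ : SymSpinor V W k l) : S.bar (φ + ψ) = S.bar φ + S.bar ψ := by
  ext v w
  simp [bar]

theorem bar_smul (c : ℂ) (φ : SymSpinor V W k l) :
    S.bar (c • φ) = starRingEnd ℂ c • S.bar φ := by
  ext v w
  simp [bar]

theorem bar_zero : S.bar (0 : SymSpinor V W k l) = 0 := by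
  ext v w
  simp [bar]

theorem metricBar_form (x y : W) : S.metricBar.form x y =
    starRingEnd ℂ (S.metric.form (S.conjEquiv.symm x) (S.conjEquiv.symm y)) := rfl

theorem bar_apply (φ : SymSpinor V W k l) (v : Fin l → V) (w : Fin k → W) :
    (S.bar φ).1 v w = starRingEnd ℂ (φ.1 (S.conjEquiv.symm ∘ w) (S.conjEquiv ∘ v)) := rfl

theorem bar_powSpinor (a : V) (b : W) : S.bar (S.powSpinor k l a b) =
    S.powSpinor l k (S.conjEquiv.symm b) (S.conjEquiv a) := by
  ext v w
  rw [bar_apply, powSpinor_apply, powSpinor_apply]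
  simp [metricBar_form, mul_comm]

theorem bar_symProd {i j r s m n : ℕ} (hm : m ≤ min i r) (hn : n ≤ min j s)
    (φ : SymSpinor V W i j) (ω : SymSpinor V W r s) :
    S.bar (S.symProd m n φ ω : SymSpinor V W (i + r - 2 * m) (j + s - 2 * n)) =
      S.symProd n m (S.bar φ) (S.bar ω) := by
  simp only [← symProdₗ_apply]
  induction φ using S.induction_powSpinor with
  | zero => simp [bar_zero]
  | add φ ψ h1 h2 => simp [h1, h2, bar_add]
  | smul c φ h => simp [h, bar_smul]
  | pow a b =>
    induction ω using S.induction_powSpinor with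
    | zero => simp [bar_zero]
    | add φ ψ h1 h2 => simp [h1, h2, bar_add]
    | smul c φ h => simp [h, bar_smul]
    | pow c d =>
      refine S.ext_const fun x y => ?_
      rw [bar_apply, bar_powSpinor, bar_powSpinor, symProdₗ_apply, symProdₗ_apply,
        S.symProd_powSpinor_powSpinor_const ⟨by omega, by omega, by omega⟩
          ⟨by omega, by omega, by omega⟩]
      refine (congrArg (starRingEnd ℂ) (S.symProd_powSpinor_powSpinor_const
        ⟨by omega, by omega, by omega⟩ ⟨by omega, by omega, by omega⟩ a c b d
        (S.conjEquiv.symm y) (S.conjEquiv x))).trans ?_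
      simp [metricBar_form, mul_comm]

/-! ### Failure of associativity -/

theorem exists_symProd_not_assoc (S : SpinSpace V W) :
    ∃ (ω φ ϕ : SymSpinor V W 1 0),
      (S.symProd 0 0 (S.symProd 1 0 ω φ : SymSpinor V W 0 0) ϕ : SymSpinor V W 1 0) ≠
        S.symProd 1 0 ω (S.symProd 0 0 φ ϕ : SymSpinor V W 2 0) := by
  obtain ⟨a, b, hab⟩ : ∃ a b, S.metric.form a b ≠ 0 :=
    ⟨_, _, by rw [S.metric.form_dualBasis 0 0]; simp⟩
  -- At the argument `b` the left bracketing gives -(ab)². The right one averages (bb)(aa) = 0 with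
  -- -(ab)² and gives half of that.
  refine ⟨S.powSpinor 1 0 a 0, S.powSpinor 1 0 b 0, S.powSpinor 1 0 a 0, fun h => ?_⟩
  have h1 := congrArg (fun f => f.1 (fun _ => b) (fun _ => 0)) h
  rw [S.symProd_powSpinor_right_const (by decide) (by decide), S.symProd_powSpinor_left_const
    (by decide) (by decide), S.symProd_powSpinor_powSpinor_tailArgs (by decide) (by decide)
    (by decide) (by decide), S.symProd_powSpinor_powSpinor_tailArgs (by decide) (by decide)
    (by decide) (by decide)] at h1
  have hba := S.metric.form_swap b a
  simp [polar, S.metric.isAlt a, S.metric.isAlt b, Nat.antidiagonal_succ, hba] at h1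
  exact hab (mul_self_eq_zero.1 (by linear_combination -2 * h1))

end SpinSpace

theorem mainTheorem1 {V W : Type*} [AddCommGroup V] [Module ℂ V] [AddCommGroup W] [Module ℂ W]
    (S : SpinSpace V W) :
    -- graded anti-commutativity
    (∀ (i j r s m n : ℕ), m ≤ min i r → n ≤ min j s →
      ∀ (φ : SymSpinor V W i j) (ω : SymSpinor V W r s),
        (S.symProd m n φ ω : SymSpinor V W (i + r - 2 * m) (j + s - 2 * n)) =
          (-1 : ℂ) ^ (m + n) • S.symProd m n ω φ) ∧
    -- non-associativity: the re-bracketing formula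
    (∀ (i j r s k l m n t u : ℕ), m ≤ min r k → n ≤ min s l →
      t ≤ min (r + k - 2 * m) i → u ≤ min (s + l - 2 * n) j →
      ∀ (ω : SymSpinor V W r s) (φ : SymSpinor V W k l) (ϕ : SymSpinor V W i j),
        (S.symProd t u
            (S.symProd m n ω φ : SymSpinor V W (r + k - 2 * m) (s + l - 2 * n)) ϕ :
          SymSpinor V W (r + k - 2 * m + i - 2 * t) (s + l - 2 * n + j - 2 * u)) =
          ∑ M ∈ Finset.range (min i k + 1), ∑ N ∈ Finset.range (min j l + 1),
            ((-1 : ℂ) ^ (t + u + M + N) *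
                (assocCoeff i r k t m M : ℂ) * (assocCoeff j s l u n N : ℂ)) •
              S.symProd (t + m - M) (u + n - N) ω
                (S.symProd M N φ ϕ : SymSpinor V W (k + i - 2 * M) (l + j - 2 * N))) ∧
    -- the coefficients vanish in all terms whose number of contractions is out of range
    (∀ (i r k m t M : ℕ), m ≤ min r k → t ≤ min (r + k - 2 * m) i → M ≤ min i k →
      ¬ (M ≤ t + m ∧ t + m - M ≤ min r (k + i - 2 * M)) → assocCoeff i r k t m M = 0) ∧
    -- non-associativity: the two bracketings differ in general
    (∃ (i j r s k l m n t u : ℕ), m ≤ min r k ∧ n ≤ min s l ∧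
      t ≤ min (r + k - 2 * m) i ∧ u ≤ min (s + l - 2 * n) j ∧
      t ≤ min k i ∧ u ≤ min l j ∧ m ≤ min r (k + i - 2 * t) ∧ n ≤ min s (l + j - 2 * u) ∧
      ∃ (ω : SymSpinor V W r s) (φ : SymSpinor V W k l) (ϕ : SymSpinor V W i j),
        (S.symProd t u
            (S.symProd m n ω φ : SymSpinor V W (r + k - 2 * m) (s + l - 2 * n)) ϕ :
          SymSpinor V W (r + k - 2 * m + i - 2 * t) (s + l - 2 * n + j - 2 * u)) ≠
          S.symProd m n ω
            (S.symProd t u φ ϕ : SymSpinor V W (k + i - 2 * t) (l + j - 2 * u))) ∧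
    -- hermiticity
    (∀ (i j r s m n : ℕ), m ≤ min i r → n ≤ min j s →
      ∀ (φ : SymSpinor V W i j) (ω : SymSpinor V W r s),
        S.bar (S.symProd m n φ ω : SymSpinor V W (i + r - 2 * m) (j + s - 2 * n)) =
          S.symProd n m (S.bar φ) (S.bar ω)) := by
  refine ⟨?_, ?_, ?_, ?_, ?_⟩
  · intro i j r s m n hm hn φ ω
    exact S.symProd_comm hm hn φ ω
  · intro i j r s k l m n t u hm hn ht hu ω φ ϕ
    exact S.symProd_assoc hm hn ht hu ω φ ϕ
  · intro i r k m t M hm ht hM h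
    exact assocCoeff_eq_zero (hm.trans (min_le_left _ _)) (hm.trans (min_le_right _ _))
      (ht.trans (min_le_right _ _)) (hM.trans (min_le_right _ _)) h
  · obtain ⟨ω, φ, ϕ, h⟩ := S.exists_symProd_not_assoc
    exact ⟨1, 0, 1, 0, 1, 0, 1, 0, 0, 0, by decide, by decide, by decide, by decide, by decide,
      by decide, by decide, by decide, ω, φ, ϕ, h⟩
  · intro i j r s m n hm hn φ ω
    exact S.bar_symProd hm hn φ ω
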